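/- **Model.** Let $\mu$ be an unknown distribution on a finite set $\Omega$ with $N=|\Omega|$. A conditional sampling algorithm is randomized and adaptive; it repeatedly queries a set $A\subseteq\Omega$ and receives a fresh independent sample from $\mu$ conditioned on $A$ (with an arbitrary answer if $\mu(A)=0$). Its sample complexity is the number of queries. **Task.** Let $\mathrm{CDF}_\mu(x)=\Pr_{y\sim\mu}[\mu(y)\le\mu(x)]$. An algorithm with output in $\mathbb R\cup\{\text{too low}\}$ solves the $(\varepsilon,c)$-estimation task at $x\in\Omega$ if, with probability at least $2/3$, its output is: "too low" when $\mathrm{CDF}_\mu(x)=0$; either "too low" or in $[(1-\varepsilon)\mu(x),(1+\varepsilon)\mu(x)]$ when $0<\mathrm{CDF}_\mu(x)<c$; in $[(1-\varepsilon)\mu(x),(1+\varepsilon)\mu(x)]$ when $\mathrm{CDF}_\mu(x)\ge c$. **Weight.** For $0<\kappa<\frac1{44}$ and $0<\eta<1$, the target test for $y\ne x$ draws $t$ uniformly from $[\frac12+\kappa,\frac6{11}-\kappa]$ and $\ell=\lceil\ln(\eta^{-1})/(2\kappa^2)\rceil$ independent samples from $\mu$ conditioned on $\{x,y\}$, and accepts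 iff fewer than $t\ell$ of them equal $y$; let $f_x(y)$ be its acceptance probability. Put $$s_x=\sum_{y\ne x,\ \mu(y)\le\mu(x)}\mu(y)+\sum_{\mu(x)<\mu(y)<1.2\,\mu(x)}\mu(y)f_x(y),\qquad w_x=\mu(x)+s_x .$$ **Theorem.** There is an absolute constant $K>0$ such that for every finite set $\Omega$ with $N=|\Omega|$, every $0<\varepsilon<\frac1{10}$ and every $0<c<\frac1{16}$ there is a conditional sampling algorithm, which receives $x\in\Omega$ as its input and does not depend on $\mu$, such that for every distribution $\mu$ on $\Omega$ the following hold ($\log\log N$ is read as $0$ for $N\le2$). 1. For every $x\in\Omega$, the algorithm solves the $(\varepsilon,c)$-estimation task at $x$, with probability $1$ it never queries a set of probability zero, and for all $\kappa,\eta$ as above its expected number of samples is at most $$K\left(\log\log N+\log\tfrac1{\varepsilon c}\cdot\left(\frac1{\varepsilon^2(w_x+c)}+\frac{\log^5\varepsilon^{-1}}{\varepsilon^4\,(w_x+\varepsilon/\log\varepsilon^{-1})}\right)\right).$$ 2. For every $x\in\Omega$, its expected number of samples is at most $K\left(\log\log N+\log\frac1{\varepsilon c}\cdot\left(\frac1{\varepsilon^2c}+\frac{\log^6\varepsilon^{-1}}{\varepsilon^5}\right)\right)$.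 3. If $x$ is drawn from $\mu$, its expected number of samples is at most $K\left(\log\log N+\log\frac1{\varepsilon c}\cdot\left(\frac{\log c^{-1}}{\varepsilon^2}+\frac{\log^6\varepsilon^{-1}}{\varepsilon^4}\right)\right)$. -/

import Mathlib

open scoped ENNReal

universe u

noncomputable section

namespace CondEst

/-! ### The conditional sampling model -/

/-- A randomized adaptive conditional sampling algorithm over the domain `Ω` with outputs in `R`.
It either halts, or makes an internal random choice (independent of the input distribution), or
asks the oracle for a sample conditioned on a set `A` and continues according to the answer.
Local computation is free; only the calls `sample` are counted. -/
inductive CondAlg (Ω : Type u) (R : Type) : Type u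
  | output (r : R) : CondAlg Ω R
  | toss (p : PMF ℕ) (next : ℕ → CondAlg Ω R) : CondAlg Ω R
  | sample (A : Set Ω) (next : Ω → CondAlg Ω R) : CondAlg Ω R

/-- `O` is a conditional sampling oracle for `μ`: on every set of positive mass it answers
according to `μ` conditioned on the set. The answers on null sets are arbitrary. -/
def IsCondOracle {Ω : Type u} (μ : PMF Ω) (O : Set Ω → PMF Ω) : Prop :=
  ∀ (A : Set Ω) (h : ∃ a ∈ A, a ∈ μ.support), O A = μ.filter A h

namespace CondAlg

variable {Ω : Type u} {R : Type}

/-- The joint distribution of the output and of the number of oracle calls. Every call is answered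
by a fresh independent draw. -/
def run (O : Set Ω → PMF Ω) : CondAlg Ω R → PMF (R × ℕ)
  | output r => PMF.pure (r, 0)
  | toss p next => p.bind fun i => run O (next i)
  | sample A next => (O A).bind fun y => (run O (next y)).map fun z => (z.1, z.2 + 1)

/-- The distribution of the output. -/
def outputDist (O : Set Ω → PMF Ω) (a : CondAlg Ω R) : PMF R :=
  (a.run O).map Prod.fst

/-- The expected number of oracle calls, over the internal randomness and the oracle's answers. -/
def expectedSamples (O : Set Ω → PMF Ω) (a : CondAlg Ω R) : ℝ≥0∞ :=
  ∑' z : R × ℕ, a.run O z * (z.2 : ℝ≥0∞)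

/-- On input distribution `μ` the algorithm never (with probability zero, on every execution path
of positive probability) asks for a sample conditioned on a `μ`-null set. -/
def NeverAsksNull (μ : PMF Ω) : CondAlg Ω R → Prop
  | output _ => True
  | toss p next => ∀ i ∈ p.support, NeverAsksNull μ (next i)
  | sample A next =>
      (∃ a ∈ A, a ∈ μ.support) ∧ ∀ y ∈ A, y ∈ μ.support → NeverAsksNull μ (next y)

end CondAlg

/-! ### The estimation task -/

/-- A distribution `D` of outputs is that of an `(ε; pl, pm)`-`f`-saturation-aware estimator of the
number `p`. The output `none` is the special value "too low". -/
def IsSaturationAware (f : ℝ → ℝ) (ε pl pm p : ℝ) (D : PMF (Option ℝ)) : Prop :=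
  (f p ≤ pl → 2 / 3 ≤ D.toOuterMeasure {none}) ∧
  (pl < f p → f p < pm →
    2 / 3 ≤ D.toOuterMeasure ({none} ∪ some '' Set.Icc ((1 - ε) * p) ((1 + ε) * p))) ∧
  (pm ≤ f p → 2 / 3 ≤ D.toOuterMeasure (some '' Set.Icc ((1 - ε) * p) ((1 + ε) * p)))

section Finite

variable {Ω : Type u} [Fintype Ω]

/-- The mass `μ(x)` as a real number. -/
def mass (μ : PMF Ω) (x : Ω) : ℝ := (μ x).toReal

open Classical in
/-- `Pr_{y ∼ μ}[μ(y) ≤ t]`. The cumulative distribution function of `μ` at the element `x` is the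
value at `t = μ(x)`. -/
def cdfAt (μ : PMF Ω) (t : ℝ) : ℝ := ∑ y : Ω with mass μ y ≤ t, mass μ y

/-- The `(ε, c)`-estimation task at `x`: an `(ε; 0, c)`-`CDF_μ`-saturation-aware estimation of
`μ(x)`. -/
def SolvesEstimationTask (ε c : ℝ) (μ : PMF Ω) (x : Ω) (D : PMF (Option ℝ)) : Prop :=
  IsSaturationAware (cdfAt μ) ε 0 c (mass μ x) D

/-! ### The target test, the scale mass and the weight -/

open Classical in
/-- `Pr[Bin(ℓ, p) < t ℓ]`. -/
def binLower (ℓ : ℕ) (p t : ℝ) : ℝ :=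
  ∑ k ∈ (Finset.range (ℓ + 1)).filter (fun k : ℕ => (k : ℝ) < t * ℓ),
    (ℓ.choose k : ℝ) * p ^ k * (1 - p) ^ (ℓ - k)

open Classical in
/-- The acceptance probability of the target test with tuning parameter `κ` and target error `η`,
comparing `y` with `x`. The test rejects if `y = x`. Otherwise it draws `t` uniformly from
`[1/2 + κ, 6/11 - κ]`, draws `ℓ = ⌈ln η⁻¹ / (2κ²)⌉` independent samples from `μ` conditioned
on `{x, y}`, and accepts iff fewer than `t ℓ` of them are equal to `y`. -/
def targetFn (κ η : ℝ) (μ : PMF Ω) (x y : Ω) : ℝ :=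
  if y = x then 0 else
    (∫ t in (1 / 2 + κ)..(6 / 11 - κ),
      binLower ⌈Real.log (1 / η) / (2 * κ ^ 2)⌉₊ (mass μ y / (mass μ x + mass μ y)) t) /
      ((6 / 11 - κ) - (1 / 2 + κ))

open Classical in
/-- The `x`-light set. -/
def lightSet (μ : PMF Ω) (x : Ω) : Finset Ω := {y | y ≠ x ∧ mass μ y ≤ mass μ x}

open Classical in
/-- The `x`-medium set. -/
def mediumSet (μ : PMF Ω) (x : Ω) : Finset Ω :=
  {y | mass μ x < mass μ y ∧ mass μ y < 1.2 * mass μ x}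

/-- The scale mass `s_x`: the expected mass of the random target set, which contains every light
element, contains a medium element `y` with the acceptance probability of the target test, and
contains no other element. -/
def scaleMass (κ η : ℝ) (μ : PMF Ω) (x : Ω) : ℝ :=
  ∑ y ∈ lightSet μ x, mass μ y + ∑ y ∈ mediumSet μ x, mass μ y * targetFn κ η μ x y

/-- The weight `w_x = μ(x) + s_x`. -/
def weight (κ η : ℝ) (μ : PMF Ω) (x : Ω) : ℝ := mass μ x + scaleMass κ η μ x

end Finite

/-! ### The sample bounds, without the constant factor -/

/-- `log log N`, read as `0` for `N ≤ 2`. -/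
def logLog (N : ℕ) : ℝ := max 0 (Real.log (Real.log N))

/-- The bound for an individual element of weight `w`. -/
def sampleBound (N : ℕ) (ε c w : ℝ) : ℝ :=
  logLog N + Real.log (1 / (ε * c)) *
    (1 / (ε ^ 2 * (w + c)) +
      Real.log (1 / ε) ^ 5 / (ε ^ 4 * (w + ε / Real.log (1 / ε))))

/-- The bound for a worst-case element. -/
def worstCaseBound (N : ℕ) (ε c : ℝ) : ℝ :=
  logLog N + Real.log (1 / (ε * c)) * (1 / (ε ^ 2 * c) + Real.log (1 / ε) ^ 6 / ε ^ 5)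

/-- The bound for an element drawn from the input distribution. -/
def averageBound (N : ℕ) (ε c : ℝ) : ℝ :=
  logLog N + Real.log (1 / (ε * c)) *
    (Real.log (1 / c) / ε ^ 2 + Real.log (1 / ε) ^ 6 / ε ^ 4)

end CondEst

end

/-!
The estimate compares `x` with other elements through single samples conditioned on pairs. A
sample conditioned on `{x, y}` returns `x` with probability `f(y) = μ(x) / (μ(x) + μ(y))`; call
`y` accepted if it does. The acceptance mass `μ(y) f(y)` of every element is at most `μ(x)`, and
it is at least `5/11 μ(y)` for the elements of mass below `1.2 μ(x)`, the only ones that count in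
the weight. With `R = ∑_{y ≠ x} f(y) μ(y) / μ(x)`, a sample from `μ` is `x` or is accepted with
probability `p = μ(x) (1 + R)`. So `p` is at least half of the CDF at `x` and `5/11` of the
weight, for all parameters of the target test (`cdfAt_le`, `weight_le`), and it suffices to use
`O(log log N + 1 / (ε² (p + c)))` samples.

The mass is recovered as `p / (1 + R)`. The waiting time for a success of a comparison has mean
`1 / p`, and `O(1 / ε²)` repetitions estimate it (`ev_waitLoop_sq_le`). For `R`, take a random set
`A` of density `α` and count the accepted elements among the samples conditioned on `A ∪ {x}`
before the first `x`. Given `A`, the count is geometric with mean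
`X = ∑_{y ∈ A, y ≠ x} f(y) μ(y) / μ(x)`. Since `X` is a sum of pairwise independent terms in
`[0, 1]` with mean `α R`, the count is an unbiased estimate of `α R` with variance at most
`(α R)² + 3 α R` (`ev_levelCount_sq_le`), and it costs `O(1 + α / μ(x))` samples. At a density of
the order of `1 / (1 + R) = μ(x) / p`, again `O(1 / ε²)` repetitions suffice, at an expected cost
of `O(1 / p)` each.

A density of this order is found in two steps. A sample conditioned on `A ∪ {x}` is different from
`x` with probability at most `α / μ(x)`, and equal to `x` with probability at most
`2 / (1 + α R)`. Both error probabilities decay geometrically with the distance of the level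
`log₂ (1 / α)` from the range between the two critical densities `μ(x)` and `1 / (1 + R)`. Hence a
plain binary search over the `O(log N)` levels, with two such samples in each of its
`O(log log N)` steps, ends near this range with a geometric tail: the result is next to a failed
and a successful test, and a union bound over the levels applies (`ev_search_rate_le`,
`ev_search_excess_le`). A linear scan then doubles the density until a count is positive. It
rarely stops too early, since the count has mean `α R` (`ev_scan_sparse_le`), and it continues
past the right density with small probability in each step while the costs only double
(`cost_scan_le`, `scanRate_le`).

A budget of `O(log log N + 1 / (ε² c))` samples, on whose exhaustion the algorithm answers "too
low", yields the dependence on `c`; by Markov's inequality it is rarely exhausted if `p ≥ c / 2`.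
The first success of the waiting loop shows that `x` has positive mass; afterwards every query
contains `x`, and before that every query is `Ω` or contains a sampled element, so null sets are
never queried. The average over `x ∼ μ` reduces to `E[1 / (c + CDF(x))] = O(log (1 / c))`
(`sum_div_add_partial_le`).

All expectations over runs are bounded by potential functions: a function of the state that does
not increase on average in one iteration bounds the result of the loop, by induction on its number
of iterations.
-/

noncomputable section

set_option linter.unusedSectionVars false

namespace CondEst

/-! ### Expectations over the runs of an algorithm -/

namespace CondAlg

variable {Ω : Type u} {R S : Type}

/-- Sequential composition: run the first algorithm and continue according to its output. -/
def bind : CondAlg Ω R → (R → CondAlg Ω S) → CondAlg Ω S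
  | output r, g => g r
  | toss p next, g => toss p fun i => bind (next i) g
  | sample A next, g => sample A fun y => bind (next y) g

/-- Sequential composition of algorithms that may fail; the output `none` is failure. -/
def obind (a : CondAlg Ω (Option R)) (g : R → CondAlg Ω (Option S)) : CondAlg Ω (Option S) :=
  a.bind fun o => o.elim (output none) g

/-- The expectation of `f` at the output, by recursion on the algorithm. -/
def ev (O : Set Ω → PMF Ω) (f : R → ℝ≥0∞) : CondAlg Ω R → ℝ≥0∞
  | output r => f r
  | toss p next => ∑' i, p i * ev O f (next i)
  | sample A next => ∑' y, O A y * ev O f (next y)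

/-- The expected number of oracle calls, by recursion on the algorithm. -/
def cost (O : Set Ω → PMF Ω) : CondAlg Ω R → ℝ≥0∞
  | output _ => 0
  | toss p next => ∑' i, p i * cost O (next i)
  | sample A next => 1 + ∑' y, O A y * cost O (next y)

theorem tsum_pmf_bind {α β : Type*} (p : PMF α) (F : α → PMF β) (h : β → ℝ≥0∞) :
    ∑' z, p.bind F z * h z = ∑' i, p i * ∑' z, F i z * h z := by
  simp only [PMF.bind_apply, ← ENNReal.tsum_mul_right, ← ENNReal.tsum_mul_left]
  rw [ENNReal.tsum_comm]
  simp only [mul_assoc]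

theorem tsum_pmf_map {α β : Type*} (p : PMF α) (F : α → β) (h : β → ℝ≥0∞) :
    ∑' z, p.map F z * h z = ∑' i, p i * h (F i) := by
  rw [← PMF.bind_pure_comp, tsum_pmf_bind]
  refine tsum_congr fun i => ?_
  congr 1
  rw [tsum_eq_single (F i)]
  · simp
  · intro b hb
    simp [hb]

theorem tsum_run_mul (O : Set Ω → PMF Ω) (f : R → ℝ≥0∞) (a : CondAlg Ω R) :
    ∑' z, a.run O z * f z.1 = a.ev O f := by
  induction a with
  | output r =>
    rw [run, ev, tsum_eq_single (r, 0)]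
    · simp
    · intro b hb
      simp [hb]
  | toss p next ih => simp only [run, ev, tsum_pmf_bind, ih]
  | sample A next ih => simp only [run, ev, tsum_pmf_bind, tsum_pmf_map, ih]

theorem expectedSamples_eq_cost (O : Set Ω → PMF Ω) (a : CondAlg Ω R) :
    a.expectedSamples O = a.cost O := by
  unfold expectedSamples
  induction a with
  | output r =>
    rw [run, cost, tsum_eq_single (r, 0)]
    · simp
    · intro b hb
      simp [hb]
  | toss p next ih => simp only [run, cost, tsum_pmf_bind, ih]
  | sample A next ih =>
    simp only [run, cost, tsum_pmf_bind, tsum_pmf_map, Nat.cast_add, Nat.cast_one, mul_add,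
      mul_one, ENNReal.tsum_add, ih, PMF.tsum_coe]
    rw [add_comm]

theorem toOuterMeasure_outputDist (O : Set Ω → PMF Ω) (a : CondAlg Ω R) (s : Set R) :
    (a.outputDist O).toOuterMeasure s = a.ev O (s.indicator 1) := by
  rw [PMF.toOuterMeasure_apply, ← tsum_run_mul, outputDist, ← tsum_pmf_map]
  refine tsum_congr fun r => ?_
  by_cases h : r ∈ s <;> simp [h]

variable (O : Set Ω → PMF Ω)

theorem ev_mono {f g : R → ℝ≥0∞} (h : ∀ r, f r ≤ g r) (a : CondAlg Ω R) :
    a.ev O f ≤ a.ev O g := by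
  induction a with
  | output r => exact h r
  | toss p next ih => exact ENNReal.tsum_le_tsum fun i => by gcongr; exact ih i
  | sample A next ih => exact ENNReal.tsum_le_tsum fun i => by gcongr; exact ih i

theorem ev_add (f g : R → ℝ≥0∞) (a : CondAlg Ω R) :
    a.ev O (fun r => f r + g r) = a.ev O f + a.ev O g := by
  induction a with
  | output r => rfl
  | toss p next ih => simp only [ev, ih, mul_add, ENNReal.tsum_add]
  | sample A next ih => simp only [ev, ih, mul_add, ENNReal.tsum_add]

theorem ev_const (c : ℝ≥0∞) (a : CondAlg Ω R) : a.ev O (fun _ => c) = c := by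
  induction a with
  | output r => rfl
  | toss p next ih => simp only [ev, ih, ENNReal.tsum_mul_right, PMF.tsum_coe, one_mul]
  | sample A next ih => simp only [ev, ih, ENNReal.tsum_mul_right, PMF.tsum_coe, one_mul]

theorem ev_const_mul (c : ℝ≥0∞) (f : R → ℝ≥0∞) (a : CondAlg Ω R) :
    a.ev O (fun r => c * f r) = c * a.ev O f := by
  induction a with
  | output r => rfl
  | toss p next ih => simp only [ev, ih, mul_left_comm _ c, ENNReal.tsum_mul_left]
  | sample A next ih => simp only [ev, ih, mul_left_comm _ c, ENNReal.tsum_mul_left]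

theorem ev_tsum {ι : Type} (f : ι → R → ℝ≥0∞) (a : CondAlg Ω R) :
    a.ev O (fun r => ∑' i, f i r) = ∑' i, a.ev O (f i) := by
  induction a with
  | output r => rfl
  | toss p next ih =>
    simp only [ev, ih, ← ENNReal.tsum_mul_left]
    rw [ENNReal.tsum_comm]
  | sample A next ih =>
    simp only [ev, ih, ← ENNReal.tsum_mul_left]
    rw [ENNReal.tsum_comm]

theorem ev_bind (f : S → ℝ≥0∞) (a : CondAlg Ω R) (g : R → CondAlg Ω S) :
    (a.bind g).ev O f = a.ev O fun r => (g r).ev O f := by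
  induction a with
  | output r => rfl
  | toss p next ih => simp only [bind, ev, ih]
  | sample A next ih => simp only [bind, ev, ih]

theorem cost_bind (a : CondAlg Ω R) (g : R → CondAlg Ω S) :
    (a.bind g).cost O = a.cost O + a.ev O fun r => (g r).cost O := by
  induction a with
  | output r => simp [bind, cost, ev]
  | toss p next ih => simp only [bind, cost, ev, ih, mul_add, ENNReal.tsum_add]
  | sample A next ih => simp only [bind, cost, ev, ih, mul_add, ENNReal.tsum_add, add_assoc]

/-- Extension of a function by zero to the failure output. -/
def onSome (f : R → ℝ≥0∞) : Option R → ℝ≥0∞ := fun o => o.elim 0 f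

@[simp] theorem onSome_some (f : R → ℝ≥0∞) (r : R) : onSome f (some r) = f r := rfl

@[simp] theorem onSome_none (f : R → ℝ≥0∞) : onSome f none = 0 := rfl

theorem onSome_mono {f g : R → ℝ≥0∞} (h : ∀ r, f r ≤ g r) (o : Option R) :
    onSome f o ≤ onSome g o := by
  cases o with
  | none => exact le_rfl
  | some r => exact h r

theorem ev_obind (f : S → ℝ≥0∞) (a : CondAlg Ω (Option R)) (g : R → CondAlg Ω (Option S)) :
    (a.obind g).ev O (onSome f) = a.ev O (onSome fun r => (g r).ev O (onSome f)) := by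
  rw [obind, ev_bind]
  congr 1
  funext o
  cases o <;> rfl

theorem cost_obind (a : CondAlg Ω (Option R)) (g : R → CondAlg Ω (Option S)) :
    (a.obind g).cost O = a.cost O + a.ev O (onSome fun r => (g r).cost O) := by
  rw [obind, cost_bind]
  congr 2
  funext o
  cases o <;> rfl

theorem ev_onSome_add (f g : R → ℝ≥0∞) (a : CondAlg Ω (Option R)) :
    a.ev O (onSome fun r => f r + g r) = a.ev O (onSome f) + a.ev O (onSome g) := by
  rw [← ev_add]
  congr 1
  funext o
  cases o <;> simp

theorem ev_onSome_const_mul (c : ℝ≥0∞) (f : R → ℝ≥0∞) (a : CondAlg Ω (Option R)) :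
    a.ev O (onSome fun r => c * f r) = c * a.ev O (onSome f) := by
  rw [← ev_const_mul]
  congr 1
  funext o
  cases o <;> simp

theorem ev_onSome_const_le (c : ℝ≥0∞) (a : CondAlg Ω (Option R)) :
    a.ev O (onSome fun _ => c) ≤ c := by
  refine (ev_mono O (g := fun _ => c) (fun o => ?_) a).trans (ev_const O c a).le
  cases o <;> simp

theorem ev_onSome_mono {f g : R → ℝ≥0∞} (h : ∀ r, f r ≤ g r) (a : CondAlg Ω (Option R)) :
    a.ev O (onSome f) ≤ a.ev O (onSome g) :=
  ev_mono O (onSome_mono h) a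

/-! ### Certified runs and sample budgets -/

/-- On input distribution `μ` the algorithm never asks for a sample conditioned on a null set, and
all its possible outputs satisfy `P`. -/
def Safe (μ : PMF Ω) (P : R → Prop) : CondAlg Ω R → Prop
  | output r => P r
  | toss p next => ∀ i ∈ p.support, Safe μ P (next i)
  | sample A next =>
      (∃ a ∈ A, a ∈ μ.support) ∧ ∀ y ∈ A, y ∈ μ.support → Safe μ P (next y)

theorem Safe.neverAsksNull {μ : PMF Ω} {P : R → Prop} {a : CondAlg Ω R} (h : a.Safe μ P) :
    a.NeverAsksNull μ := by
  induction a with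
  | output r => trivial
  | toss p next ih => exact fun i hi => ih i (h i hi)
  | sample A next ih => exact ⟨h.1, fun y hy hy' => ih y (h.2 y hy hy')⟩

theorem Safe.bind {μ : PMF Ω} {P : R → Prop} {Q : S → Prop} {a : CondAlg Ω R}
    {g : R → CondAlg Ω S} (h : a.Safe μ P) (hg : ∀ r, P r → (g r).Safe μ Q) :
    (a.bind g).Safe μ Q := by
  induction a with
  | output r => exact hg r h
  | toss p next ih => exact fun i hi => ih i (h i hi)
  | sample A next ih => exact ⟨h.1, fun y hy hy' => ih y (h.2 y hy hy')⟩

theorem oracle_apply_eq_zero {μ : PMF Ω} {O : Set Ω → PMF Ω} (hO : IsCondOracle μ O) {A : Set Ω}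
    (hA : ∃ a ∈ A, a ∈ μ.support) {y : Ω} (hy : ¬(y ∈ A ∧ y ∈ μ.support)) : O A y = 0 := by
  rw [hO A hA, PMF.filter_apply_eq_zero_iff]
  tauto

theorem Safe.ev_eq_zero {μ : PMF Ω} {O : Set Ω → PMF Ω} (hO : IsCondOracle μ O) {P : R → Prop}
    {a : CondAlg Ω R} (h : a.Safe μ P) {f : R → ℝ≥0∞} (hf : ∀ r, P r → f r = 0) :
    a.ev O f = 0 := by
  induction a with
  | output r => exact hf r h
  | toss p next ih =>
    rw [ev, ENNReal.tsum_eq_zero]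
    intro i
    by_cases hi : i ∈ p.support
    · rw [ih i (h i hi), mul_zero]
    · rw [(PMF.apply_eq_zero_iff p i).2 hi, zero_mul]
  | sample A next ih =>
    rw [ev, ENNReal.tsum_eq_zero]
    intro y
    by_cases hy : y ∈ A ∧ y ∈ μ.support
    · rw [ih y (h.2 y hy.1 hy.2), mul_zero]
    · rw [oracle_apply_eq_zero hO h.1 hy, zero_mul]

/-- The algorithm cut off when it asks for its `(n + 1)`-st sample; it then fails. -/
def limit : ℕ → CondAlg Ω (Option R) → CondAlg Ω (Option R)
  | _, output r => output r
  | n, toss p next => toss p fun i => limit n (next i)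
  | 0, sample _ _ => output none
  | n + 1, sample A next => sample A fun y => limit n (next y)

/-- Every run that fails has used at least `n` samples. -/
def NoneAfter : ℕ → CondAlg Ω (Option R) → Prop
  | n, output r => r = none → n = 0
  | n, toss _ next => ∀ i, NoneAfter n (next i)
  | n, sample _ next => ∀ y, NoneAfter (n - 1) (next y)

theorem NoneAfter.mono {n m : ℕ} (hmn : m ≤ n) {a : CondAlg Ω (Option R)} (h : a.NoneAfter n) :
    a.NoneAfter m := by
  induction a generalizing n m with
  | output r => exact fun hr => by have := h hr; omega
  | toss p next ih => exact fun i => ih i hmn (h i)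
  | sample A next ih => exact fun y => ih y (by omega) (h y)

theorem NoneAfter.obind {n : ℕ} {a : CondAlg Ω (Option R)} {g : R → CondAlg Ω (Option S)}
    (h : a.NoneAfter n) (hg : ∀ r, (g r).NoneAfter n) : (a.obind g).NoneAfter n := by
  unfold CondAlg.obind
  induction a generalizing n with
  | output r =>
    cases r with
    | none => exact fun _ => h rfl
    | some r => exact hg r
  | toss p next ih => exact fun i => ih i (h i) hg
  | sample A next ih => exact fun y => ih y (h y) fun r => (hg r).mono (by omega)

theorem NoneAfter.bind {n : ℕ} {a : CondAlg Ω R} {g : R → CondAlg Ω (Option S)}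
    (hg : ∀ r, (g r).NoneAfter n) : (a.bind g).NoneAfter n := by
  induction a generalizing n with
  | output r => exact hg r
  | toss p next ih => exact fun i => ih i hg
  | sample A next ih => exact fun y => ih y fun r => (hg r).mono (by omega)

theorem Safe.limit {μ : PMF Ω} {P : Option R → Prop} (hP : P none) {a : CondAlg Ω (Option R)}
    (h : a.Safe μ P) (n : ℕ) : (a.limit n).Safe μ P := by
  induction a generalizing n with
  | output r => cases n <;> exact h
  | toss p next ih => cases n <;> exact fun i hi => ih i (h i hi) _
  | sample A next ih =>
    cases n with
    | zero => exact hP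
    | succ n => exact ⟨h.1, fun y hy hy' => ih y (h.2 y hy hy') n⟩

theorem tsum_pmf_mul_le {α : Type*} (p : PMF α) {f : α → ℝ≥0∞} {c : ℝ≥0∞} (h : ∀ i, f i ≤ c) :
    ∑' i, p i * f i ≤ c := by
  calc ∑' i, p i * f i ≤ ∑' i, p i * c := ENNReal.tsum_le_tsum fun i => by gcongr; exact h i
    _ = c := by rw [ENNReal.tsum_mul_right, PMF.tsum_coe, one_mul]

theorem cost_limit_le_nat (a : CondAlg Ω (Option R)) (n : ℕ) : (a.limit n).cost O ≤ n := by
  induction a generalizing n with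
  | output r => cases n <;> simp [limit, cost]
  | toss p next ih => cases n <;> exact tsum_pmf_mul_le _ fun i => ih i _
  | sample A next ih =>
    cases n with
    | zero => simp [limit, cost]
    | succ n =>
      rw [limit, cost, Nat.cast_add, Nat.cast_one, add_comm]
      gcongr
      exact tsum_pmf_mul_le _ fun i => ih i _

theorem cost_limit_le (a : CondAlg Ω (Option R)) (n : ℕ) : (a.limit n).cost O ≤ a.cost O := by
  induction a generalizing n with
  | output r => cases n <;> simp [limit, cost]
  | toss p next ih =>
    cases n <;> exact ENNReal.tsum_le_tsum fun i => by gcongr; exact ih i _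
  | sample A next ih =>
    cases n with
    | zero => simp [limit, cost]
    | succ n =>
      rw [limit, cost, cost]
      gcongr
      exact ih _ _

theorem ev_limit_le (f : R → ℝ≥0∞) (a : CondAlg Ω (Option R)) (n : ℕ) :
    (a.limit n).ev O (onSome f) ≤ a.ev O (onSome f) := by
  induction a generalizing n with
  | output r => cases n <;> simp [limit, ev]
  | toss p next ih =>
    cases n <;> exact ENNReal.tsum_le_tsum fun i => by gcongr; exact ih i _
  | sample A next ih =>
    cases n with
    | zero => simp [limit, ev]
    | succ n =>
      rw [limit, ev, ev]
      gcongr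
      exact ih _ _

/-- Markov's inequality: a budget of `n` samples is exceeded with probability at most the expected
number of samples over `n`. -/
theorem mul_ev_limit_none_le {a : CondAlg Ω (Option R)} {n : ℕ} (h : a.NoneAfter n) :
    n * (a.limit n).ev O (Set.indicator {none} 1) ≤ a.cost O := by
  induction a generalizing n with
  | output r =>
    cases r with
    | none => simp [show n = 0 from h rfl]
    | some r => cases n <;> simp [limit, ev]
  | toss p next ih =>
    have : (limit n (toss p next)) = toss p fun i => limit n (next i) := by cases n <;> rfl
    rw [this, ev, cost, ← ENNReal.tsum_mul_left]
    refine ENNReal.tsum_le_tsum fun i => ?_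
    rw [mul_left_comm]
    gcongr
    exact ih i (h i)
  | sample A next ih =>
    cases n with
    | zero => simp
    | succ n =>
      rw [limit, ev, cost, ← ENNReal.tsum_mul_left, ← PMF.tsum_coe (O A), ← ENNReal.tsum_add]
      refine ENNReal.tsum_le_tsum fun y => ?_
      have h1 := ih y (h y)
      have h2 : ((next y).limit n).ev O (Set.indicator {none} 1) ≤ 1 := by
        refine (ev_mono O (fun r => ?_) _).trans (ev_const O 1 _).le
        exact Set.indicator_le_self' (fun _ _ => zero_le) _
      calc ((n + 1 : ℕ) : ℝ≥0∞) * (O A y * ((next y).limit n).ev O (Set.indicator {none} 1))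
          = O A y * (((next y).limit n).ev O (Set.indicator {none} 1) +
              n * ((next y).limit n).ev O (Set.indicator {none} 1)) := by
            push_cast; ring
        _ ≤ O A y * (1 + (next y).cost O) := by
            gcongr
            exact h1
        _ = _ := by ring

end CondAlg

/-! ### Random sets of a given density -/

section RandomSet

variable {Ω : Type u} [Fintype Ω]

open Classical in
/-- The probability of `A` when every element is included independently with probability `α`. -/
def setWeight (α : ℝ) (A : Finset Ω) : ℝ := (∏ _y ∈ A, α) * ∏ _y ∈ Aᶜ, (1 - α)

/-- The inclusion probability at level `i`. -/
def rate (i : ℕ) : ℝ := (1 / 2) ^ i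

theorem rate_pos (i : ℕ) : 0 < rate i := by unfold rate; positivity

theorem rate_le_one (i : ℕ) : rate i ≤ 1 := pow_le_one₀ (by norm_num) (by norm_num)

theorem rate_zero : rate 0 = 1 := pow_zero _

theorem rate_succ (i : ℕ) : rate (i + 1) = rate i / 2 := by unfold rate; ring

theorem setWeight_nonneg {α : ℝ} (h0 : 0 ≤ α) (h1 : α ≤ 1) (A : Finset Ω) :
    0 ≤ setWeight α A :=
  mul_nonneg (Finset.prod_nonneg fun _ _ => h0) (Finset.prod_nonneg fun _ _ => sub_nonneg.2 h1)

open Classical in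
/-- A fixed set is covered with probability `α ^ #B`. -/
theorem sum_setWeight_subset (α : ℝ) (B : Finset Ω) :
    ∑ A : Finset Ω, (if B ⊆ A then setWeight α A else 0) = α ^ B.card := by
  -- Expand the product of `α + g y`, where `g y` is `0` on `B` and `1 - α` elsewhere.
  have h := Finset.prod_add (fun _ : Ω => α) (fun y => if y ∈ B then 0 else 1 - α) Finset.univ
  have hl : ∏ y : Ω, (α + if y ∈ B then 0 else 1 - α) = α ^ B.card := by
    have : ∀ y : Ω, (α + if y ∈ B then 0 else 1 - α) = if y ∈ B then α else 1 := by
      intro y; split_ifs <;> ring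
    simp_rw [this]
    simp
  rw [← hl, h, Finset.powerset_univ]
  refine Finset.sum_congr rfl fun A _ => ?_
  unfold setWeight
  rw [← Finset.compl_eq_univ_sdiff]
  split_ifs with hBA
  · congr 1
    refine Finset.prod_congr rfl fun y hy => ?_
    rw [if_neg]
    exact fun hyB => (Finset.mem_compl.1 hy) (hBA hyB)
  · obtain ⟨y, hyB, hyA⟩ := Finset.not_subset.1 hBA
    have h0 : ∏ y ∈ Aᶜ, (if y ∈ B then 0 else 1 - α) = 0 :=
      Finset.prod_eq_zero (Finset.mem_compl.2 hyA) (if_pos hyB)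
    rw [h0, mul_zero]

theorem sum_setWeight (α : ℝ) : ∑ A : Finset Ω, setWeight α A = 1 := by
  have := sum_setWeight_subset (Ω := Ω) α ∅
  simpa using this

open Classical in
theorem sum_setWeight_mul_sum (α : ℝ) (h : Ω → ℝ) :
    ∑ A : Finset Ω, setWeight α A * ∑ y ∈ A, h y = α * ∑ y, h y := by
  have h1 : ∀ A : Finset Ω, setWeight α A * ∑ y ∈ A, h y =
      ∑ y, h y * if {y} ⊆ A then setWeight α A else 0 := by
    intro A
    rw [Finset.mul_sum, ← Finset.sum_filter_add_sum_filter_not Finset.univ (· ∈ A)]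
    rw [Finset.sum_eq_zero (s := Finset.univ.filter fun y => ¬y ∈ A), add_zero]
    · refine Finset.sum_congr (by ext; simp) fun y hy => ?_
      have : y ∈ A := by simpa using hy
      simp [this, mul_comm]
    · intro y hy
      have : y ∉ A := by simpa using hy
      simp [this]
  simp_rw [h1]
  rw [Finset.sum_comm, Finset.mul_sum]
  refine Finset.sum_congr rfl fun y _ => ?_
  rw [← Finset.mul_sum, sum_setWeight_subset]
  simp [mul_comm]

open Classical in
/-- The second moment of a sum over the random set. The variance is at most the mean, because the
summands are pairwise independent with values in `[0, 1]`. -/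
theorem sum_setWeight_mul_sq_le {α : ℝ} (h0 : 0 ≤ α) {h : Ω → ℝ}
    (hh0 : ∀ y, 0 ≤ h y) (hh1 : ∀ y, h y ≤ 1) :
    ∑ A : Finset Ω, setWeight α A * (∑ y ∈ A, h y) ^ 2 ≤
      α * ∑ y, h y + (α * ∑ y, h y) ^ 2 := by
  have h1 : ∀ A : Finset Ω, setWeight α A * (∑ y ∈ A, h y) ^ 2 =
      ∑ y, ∑ z, h y * h z * if {y, z} ⊆ A then setWeight α A else 0 := by
    intro A
    have : ∑ y ∈ A, h y = ∑ y, if y ∈ A then h y else 0 := by simp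
    rw [this, sq, Finset.sum_mul_sum, Finset.mul_sum]
    refine Finset.sum_congr rfl fun y _ => ?_
    rw [Finset.mul_sum]
    refine Finset.sum_congr rfl fun z _ => ?_
    by_cases hy : y ∈ A <;> by_cases hz : z ∈ A <;>
      simp [hy, hz, Finset.insert_subset_iff, mul_comm]
  simp_rw [h1]
  rw [Finset.sum_comm]
  have h2 : ∀ y : Ω, ∑ A : Finset Ω, ∑ z, h y * h z * (if {y, z} ⊆ A then setWeight α A else 0)
      ≤ α * h y + ∑ z, (α * h y) * (α * h z) := by
    intro y
    rw [Finset.sum_comm]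
    have h3 : ∀ z : Ω, ∑ A : Finset Ω, h y * h z * (if {y, z} ⊆ A then setWeight α A else 0)
        ≤ (if z = y then α * h y else 0) + (α * h y) * (α * h z) := by
      intro z
      rw [← Finset.mul_sum, sum_setWeight_subset]
      by_cases hz : z = y
      · subst hz
        have := hh0 z
        have := hh1 z
        simp only [Finset.pair_eq_singleton, Finset.card_singleton, pow_one, if_true]
        have : h z * h z * α ≤ 1 * h z * α := by gcongr
        nlinarith [mul_nonneg (mul_nonneg h0 (hh0 z)) (mul_nonneg h0 (hh0 z))]
      · rw [Finset.card_pair (Ne.symm hz), if_neg hz]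
        apply le_of_eq; ring
    refine (Finset.sum_le_sum fun z _ => h3 z).trans ?_
    rw [Finset.sum_add_distrib]
    simp
  refine (Finset.sum_le_sum fun y _ => h2 y).trans ?_
  rw [Finset.sum_add_distrib, ← Finset.mul_sum, ← Finset.sum_mul_sum, ← Finset.mul_sum, sq]

/-- The random set of level `i`: every element is included independently with probability
`2 ^ (-i)`. -/
def randSet (i : ℕ) : PMF (Finset Ω) :=
  PMF.ofFintype (fun A => ENNReal.ofReal (setWeight (rate i) A)) (by
    rw [← ENNReal.ofReal_sum_of_nonneg fun A _ =>
      setWeight_nonneg (rate_pos i).le (rate_le_one i) A, sum_setWeight, ENNReal.ofReal_one])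

/-- A numbering of the subsets, to present a random set as a random natural number. -/
def decodeSet (n : ℕ) : Finset Ω :=
  if h : n < Fintype.card (Finset Ω) then (Fintype.equivFin (Finset Ω)).symm ⟨n, h⟩ else ∅

theorem decodeSet_equivFin (A : Finset Ω) :
    decodeSet (Fintype.equivFin (Finset Ω) A : ℕ) = A := by
  rw [decodeSet, dif_pos (Fin.is_lt _)]
  simp

end RandomSet

namespace CondAlg

variable {Ω : Type u} [Fintype Ω] {R : Type}

/-- Draw a random set of level `i` and continue with it. -/
def tossSet (i : ℕ) (next : Finset Ω → CondAlg Ω R) : CondAlg Ω R :=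
  toss ((randSet i).map fun A => (Fintype.equivFin (Finset Ω) A : ℕ)) fun n => next (decodeSet n)

theorem ev_tossSet (O : Set Ω → PMF Ω) (f : R → ℝ≥0∞) (i : ℕ) (next : Finset Ω → CondAlg Ω R) :
    (tossSet i next).ev O f =
      ∑ A, ENNReal.ofReal (setWeight (rate i) A) * (next A).ev O f := by
  rw [tossSet, ev, tsum_pmf_map, tsum_fintype]
  simp [decodeSet_equivFin, randSet]

theorem cost_tossSet (O : Set Ω → PMF Ω) (i : ℕ) (next : Finset Ω → CondAlg Ω R) :
    (tossSet i next).cost O =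
      ∑ A, ENNReal.ofReal (setWeight (rate i) A) * (next A).cost O := by
  rw [tossSet, cost, tsum_pmf_map, tsum_fintype]
  simp [decodeSet_equivFin, randSet]

theorem Safe.tossSet {μ : PMF Ω} {P : R → Prop} {i : ℕ} {next : Finset Ω → CondAlg Ω R}
    (h : ∀ A, (next A).Safe μ P) : (tossSet i next).Safe μ P :=
  fun _ _ => h _

end CondAlg

theorem sum_setWeight_ofReal_le {Ω : Type u} [Fintype Ω] (i : ℕ) {F : Finset Ω → ℝ≥0∞}
    {h : Finset Ω → ℝ} (hF : ∀ A, F A ≤ ENNReal.ofReal (h A)) (h0 : ∀ A, 0 ≤ h A) :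
    ∑ A, ENNReal.ofReal (setWeight (rate i) A) * F A ≤
      ENNReal.ofReal (∑ A, setWeight (rate i) A * h A) := by
  have hw := fun A : Finset Ω => setWeight_nonneg (rate_pos i).le (rate_le_one i) A
  rw [ENNReal.ofReal_sum_of_nonneg fun A _ => mul_nonneg (hw A) (h0 A)]
  refine Finset.sum_le_sum fun A _ => ?_
  rw [ENNReal.ofReal_mul (hw A)]
  gcongr
  exact hF A

/-! ### One comparison with the input element -/

section Draw

variable {Ω : Type u} [Fintype Ω]

theorem mass_nonneg (μ : PMF Ω) (y : Ω) : 0 ≤ mass μ y := ENNReal.toReal_nonneg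

theorem ofReal_mass (μ : PMF Ω) (y : Ω) : ENNReal.ofReal (mass μ y) = μ y :=
  ENNReal.ofReal_toReal (PMF.apply_ne_top μ y)

theorem mass_pos_iff (μ : PMF Ω) (y : Ω) : 0 < mass μ y ↔ y ∈ μ.support := by
  rw [PMF.mem_support_iff, (mass_nonneg μ y).lt_iff_ne, ne_comm, mass, Ne, Ne,
    ENNReal.toReal_eq_zero_iff]
  simp [PMF.apply_ne_top]

theorem sum_mass (μ : PMF Ω) : ∑ y, mass μ y = 1 := by
  have h := PMF.tsum_coe μ
  rw [tsum_fintype] at h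
  unfold mass
  rw [← ENNReal.toReal_sum fun y _ => PMF.apply_ne_top μ y, h, ENNReal.toReal_one]

open Classical in
theorem oracle_apply {μ : PMF Ω} {O : Set Ω → PMF Ω} (hO : IsCondOracle μ O) (B : Finset Ω)
    (hB : 0 < ∑ y ∈ B, mass μ y) (y : Ω) :
    O (B : Set Ω) y = if y ∈ B then ENNReal.ofReal (mass μ y / ∑ y ∈ B, mass μ y) else 0 := by
  obtain ⟨a, ha, ha'⟩ := Finset.exists_lt_of_sum_lt (s := B) (f := fun _ => (0 : ℝ))
    (g := mass μ) (by simpa using hB)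
  have hex : ∃ a ∈ (B : Set Ω), a ∈ μ.support := ⟨a, ha, (mass_pos_iff μ a).1 ha'⟩
  rw [hO _ hex, PMF.filter_apply]
  have hs : ∑' z, (B : Set Ω).indicator μ z = ENNReal.ofReal (∑ y ∈ B, mass μ y) := by
    rw [tsum_fintype, ENNReal.ofReal_sum_of_nonneg fun y _ => mass_nonneg μ y]
    simp [Set.indicator_apply, ofReal_mass]
  rw [hs]
  split_ifs with h
  · rw [Set.indicator_of_mem (by simpa using h), ENNReal.ofReal_div_of_pos hB, ofReal_mass,
      div_eq_mul_inv]
  · rw [Set.indicator_of_notMem (by simpa using h), zero_mul]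

open Classical in
theorem tsum_oracle_le {μ : PMF Ω} {O : Set Ω → PMF Ω} (hO : IsCondOracle μ O) {B : Finset Ω}
    (hB : 0 < ∑ y ∈ B, mass μ y) {F : Ω → ℝ≥0∞} {h : Ω → ℝ}
    (hF : ∀ y ∈ B, F y ≤ ENNReal.ofReal (h y)) (h0 : ∀ y ∈ B, 0 ≤ h y) :
    ∑' y, O (B : Set Ω) y * F y ≤
      ENNReal.ofReal ((∑ y ∈ B, mass μ y * h y) / ∑ y ∈ B, mass μ y) := by
  rw [tsum_fintype, Finset.sum_div, ENNReal.ofReal_sum_of_nonneg fun y hy =>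
    div_nonneg (mul_nonneg (mass_nonneg μ y) (h0 y hy)) hB.le]
  simp_rw [oracle_apply hO B hB]
  simp only [ite_mul, zero_mul, Finset.sum_ite_mem, Finset.univ_inter]
  refine Finset.sum_le_sum fun y hy => ?_
  rw [mul_div_right_comm, ENNReal.ofReal_mul (div_nonneg (mass_nonneg μ y) hB.le)]
  gcongr
  exact hF y hy

/-- The relative acceptance mass `μ(y) f(y) / μ(x)`, where `f(y) = μ(x) / (μ(x) + μ(y))` is the
probability that a single sample conditioned on `{x, y}` returns `x`. -/
def accept (μ : PMF Ω) (x y : Ω) : ℝ := mass μ y / (mass μ x + mass μ y)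

theorem accept_nonneg (μ : PMF Ω) (x y : Ω) : 0 ≤ accept μ x y :=
  div_nonneg (mass_nonneg μ y) (add_nonneg (mass_nonneg μ x) (mass_nonneg μ y))

theorem accept_le_one (μ : PMF Ω) (x y : Ω) : accept μ x y ≤ 1 :=
  div_le_one_of_le₀ (by linarith [mass_nonneg μ x])
    (add_nonneg (mass_nonneg μ x) (mass_nonneg μ y))

open Classical in
/-- The relative acceptance mass of a set, not counting `x` itself. -/
def acceptSum (μ : PMF Ω) (x : Ω) (A : Finset Ω) : ℝ := ∑ y ∈ A.erase x, accept μ x y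

open Classical in
/-- The probability that a sample conditioned on `A ∪ {x}` is `x`. -/
def hitProb (μ : PMF Ω) (x : Ω) (A : Finset Ω) : ℝ := mass μ x / ∑ y ∈ insert x A, mass μ y

theorem acceptSum_nonneg (μ : PMF Ω) (x : Ω) (A : Finset Ω) : 0 ≤ acceptSum μ x A :=
  Finset.sum_nonneg fun y _ => accept_nonneg μ x y

open Classical in
theorem sum_insert_mass_eq (μ : PMF Ω) (x : Ω) (A : Finset Ω) :
    ∑ y ∈ insert x A, mass μ y = mass μ x + ∑ y ∈ A.erase x, mass μ y := by
  rw [← Finset.insert_erase (Finset.mem_insert_self x A), Finset.sum_insert (by simp),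
    Finset.erase_insert_eq_erase]

open Classical in
theorem sum_insert_mass_pos {μ : PMF Ω} {x : Ω} (hx : 0 < mass μ x) (A : Finset Ω) :
    0 < ∑ y ∈ insert x A, mass μ y := by
  rw [sum_insert_mass_eq]
  have := Finset.sum_nonneg (s := A.erase x) fun y _ => mass_nonneg μ y
  linarith

theorem hitProb_pos {μ : PMF Ω} {x : Ω} (hx : 0 < mass μ x) (A : Finset Ω) :
    0 < hitProb μ x A :=
  div_pos hx (sum_insert_mass_pos hx A)

open Classical in
theorem inv_hitProb {μ : PMF Ω} {x : Ω} (hx : 0 < mass μ x) (A : Finset Ω) :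
    1 / hitProb μ x A = 1 + (∑ y ∈ A.erase x, mass μ y) / mass μ x := by
  rw [hitProb, sum_insert_mass_eq]
  field_simp

theorem hitProb_mul_le {μ : PMF Ω} {x : Ω} (hx : 0 < mass μ x) (A : Finset Ω) :
    hitProb μ x A * (1 + acceptSum μ x A) ≤ 1 := by
  classical
  have h1 : acceptSum μ x A ≤ (∑ y ∈ A.erase x, mass μ y) / mass μ x := by
    rw [acceptSum, Finset.sum_div]
    refine Finset.sum_le_sum fun y _ => ?_
    have := mass_nonneg μ y
    exact div_le_div_of_nonneg_left this hx (by linarith)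
  have h2 := inv_hitProb hx A
  have h3 := hitProb_pos hx A
  calc hitProb μ x A * (1 + acceptSum μ x A) ≤ hitProb μ x A * (1 / hitProb μ x A) := by
        rw [h2]; gcongr
    _ = 1 := by field_simp

namespace CondAlg

variable {R : Type}

open Classical in
/-- Draw a sample `y` conditioned on `A ∪ {x}`. If it is `x`, continue with `onHit`. Otherwise draw
one sample conditioned on `{x, y}` and continue with `onAcc` if it is `x`, with `onRej` if not. -/
def draw (x : Ω) (A : Finset Ω) (onHit onAcc onRej : CondAlg Ω R) : CondAlg Ω R :=
  sample ((insert x A : Finset Ω) : Set Ω) fun y =>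
    if y = x then onHit else
      sample (({x, y} : Finset Ω) : Set Ω) fun z => if z = x then onAcc else onRej

variable {μ : PMF Ω} {O : Set Ω → PMF Ω} {x : Ω}

open Classical in
theorem tsum_pair_le (hO : IsCondOracle μ O) (hx : 0 < mass μ x) {y : Ω} (hy : y ≠ x)
    {F : Ω → ℝ≥0∞} {v w : ℝ} (hv : 0 ≤ v) (hw : 0 ≤ w) (hFv : F x ≤ ENNReal.ofReal v)
    (hFw : F y ≤ ENNReal.ofReal w) :
    ∑' z, O (({x, y} : Finset Ω) : Set Ω) z * F z ≤
      ENNReal.ofReal ((1 - accept μ x y) * v + accept μ x y * w) := by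
  have h1 : ∑ z ∈ ({x, y} : Finset Ω), mass μ z = mass μ x + mass μ y :=
    Finset.sum_pair hy.symm
  have hpos : 0 < mass μ x + mass μ y := by linarith [mass_nonneg μ y]
  refine (tsum_oracle_le hO (B := {x, y}) (h := fun z => if z = x then v else w)
    (by rw [h1]; exact hpos) ?_ ?_).trans ?_
  · intro z hz
    rcases Finset.mem_insert.1 hz with rfl | hz
    · simpa using hFv
    · rw [Finset.mem_singleton.1 hz]; simpa [hy] using hFw
  · intro z _
    split_ifs <;> assumption
  · rw [h1, Finset.sum_pair hy.symm]
    apply ENNReal.ofReal_le_ofReal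
    simp only [if_true, hy, if_false, accept]
    apply le_of_eq
    field_simp
    ring

open Classical in
/-- The expectation over one comparison: `x` is drawn with probability `q`, another element is
accepted with probability `q X`, and rejected otherwise. -/
theorem tsum_draw_le (hO : IsCondOracle μ O) (hx : 0 < mass μ x) (A : Finset Ω) {F : Ω → ℝ≥0∞}
    {a u v w : ℝ} (hu : 0 ≤ u) (hav : 0 ≤ a + v) (haw : 0 ≤ a + w)
    (hFu : F x ≤ ENNReal.ofReal u)
    (hF : ∀ y, y ≠ x → F y ≤
      ENNReal.ofReal (a + ((1 - accept μ x y) * v + accept μ x y * w))) :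
    ∑' y, O ((insert x A : Finset Ω) : Set Ω) y * F y ≤
      ENNReal.ofReal (hitProb μ x A * u + hitProb μ x A * acceptSum μ x A * (a + v) +
        (1 - hitProb μ x A - hitProb μ x A * acceptSum μ x A) * (a + w)) := by
  have hM := sum_insert_mass_pos hx A
  refine (tsum_oracle_le hO hM
    (h := fun y => if y = x then u else a + ((1 - accept μ x y) * v + accept μ x y * w))
    ?_ ?_).trans ?_
  · intro y _
    by_cases hy : y = x
    · simpa [hy] using hFu
    · simpa [hy] using hF y hy
  · intro y _
    split_ifs
    · exact hu
    · have h0 := accept_nonneg μ x y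
      have h1 := accept_le_one μ x y
      nlinarith
  · apply ENNReal.ofReal_le_ofReal
    apply le_of_eq
    have hsum : ∑ y ∈ insert x A, mass μ y *
        (if y = x then u else a + ((1 - accept μ x y) * v + accept μ x y * w)) =
        mass μ x * u + ((a + w) * ∑ y ∈ A.erase x, mass μ y +
          mass μ x * (v - w) * acceptSum μ x A) := by
      rw [← Finset.insert_erase (Finset.mem_insert_self x A), Finset.sum_insert (by simp),
        Finset.erase_insert_eq_erase, if_pos rfl, acceptSum, Finset.mul_sum, Finset.mul_sum,
        ← Finset.sum_add_distrib]
      congr 1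
      refine Finset.sum_congr rfl fun y hy => ?_
      rw [if_neg (Finset.ne_of_mem_erase hy), accept]
      have : 0 < mass μ x + mass μ y := by linarith [mass_nonneg μ y]
      field_simp
      ring
    rw [hsum, hitProb]
    have h3 := sum_insert_mass_eq μ x A
    have h4 : ∑ y ∈ A.erase x, mass μ y = ∑ y ∈ insert x A, mass μ y - mass μ x := by linarith
    rw [h4]
    field_simp
    ring

open Classical in
theorem ev_draw_le (hO : IsCondOracle μ O) (hx : 0 < mass μ x) (A : Finset Ω) {f : R → ℝ≥0∞}
    {onHit onAcc onRej : CondAlg Ω R} {u v w : ℝ} (hu : 0 ≤ u) (hv : 0 ≤ v) (hw : 0 ≤ w)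
    (hHit : onHit.ev O f ≤ ENNReal.ofReal u) (hAcc : onAcc.ev O f ≤ ENNReal.ofReal v)
    (hRej : onRej.ev O f ≤ ENNReal.ofReal w) :
    (draw x A onHit onAcc onRej).ev O f ≤
      ENNReal.ofReal (hitProb μ x A * u + hitProb μ x A * acceptSum μ x A * v +
        (1 - hitProb μ x A - hitProb μ x A * acceptSum μ x A) * w) := by
  have := tsum_draw_le hO hx A (F := fun y => ((if y = x then onHit else
      sample (({x, y} : Finset Ω) : Set Ω) fun z => if z = x then onAcc else onRej :
        CondAlg Ω R).ev O f)) (a := 0) hu (by simpa using hv) (by simpa using hw)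
    (by simpa using hHit) (fun y hy => ?_)
  · simpa [draw, ev] using this
  · rw [if_neg hy, ev, zero_add]
    exact tsum_pair_le hO hx hy hv hw (by simpa using hAcc) (by simpa [hy] using hRej)

open Classical in
theorem cost_draw_le (hO : IsCondOracle μ O) (hx : 0 < mass μ x) (A : Finset Ω)
    {onHit onAcc onRej : CondAlg Ω R} {u v w : ℝ} (hu : 0 ≤ u) (hv : 0 ≤ v) (hw : 0 ≤ w)
    (hHit : onHit.cost O ≤ ENNReal.ofReal u) (hAcc : onAcc.cost O ≤ ENNReal.ofReal v)
    (hRej : onRej.cost O ≤ ENNReal.ofReal w) :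
    (draw x A onHit onAcc onRej).cost O ≤
      ENNReal.ofReal (2 + (hitProb μ x A * u + hitProb μ x A * acceptSum μ x A * v +
        (1 - hitProb μ x A - hitProb μ x A * acceptSum μ x A) * w)) := by
  have hq := hitProb_pos hx A
  have hX := acceptSum_nonneg μ x A
  have hqX := hitProb_mul_le hx A
  have h1 := tsum_draw_le hO hx A (F := fun y => ((if y = x then onHit else
      sample (({x, y} : Finset Ω) : Set Ω) fun z => if z = x then onAcc else onRej :
        CondAlg Ω R).cost O)) (a := 1) (v := v) (w := w) hu (by linarith) (by linarith)
    (by simpa using hHit) (fun y hy => ?_)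
  · rw [draw, cost]
    refine (add_le_add ENNReal.ofReal_one.ge h1).trans ?_
    rw [← ENNReal.ofReal_add zero_le_one (by
      have : 0 ≤ 1 - hitProb μ x A - hitProb μ x A * acceptSum μ x A := by linarith
      positivity)]
    apply ENNReal.ofReal_le_ofReal
    linarith
  · have h0 := accept_nonneg μ x y
    have h1' : 0 ≤ 1 - accept μ x y := sub_nonneg.2 (accept_le_one μ x y)
    rw [if_neg hy, cost, ENNReal.ofReal_add zero_le_one (by positivity), ENNReal.ofReal_one]
    gcongr
    exact tsum_pair_le hO hx hy hv hw (by simpa using hAcc) (by simpa [hy] using hRej)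

theorem Safe.draw {P : R → Prop} {A : Finset Ω} {onHit onAcc onRej : CondAlg Ω R}
    (hA : x ∈ μ.support ∨ ∃ a ∈ A, a ∈ μ.support)
    (hHit : x ∈ μ.support → onHit.Safe μ P) (hAcc : x ∈ μ.support → onAcc.Safe μ P)
    (hRej : onRej.Safe μ P) : (draw x A onHit onAcc onRej).Safe μ P := by
  refine ⟨?_, fun y _ hy => ?_⟩
  · rcases hA with h | ⟨a, ha, ha'⟩
    · exact ⟨x, by simp, h⟩
    · exact ⟨a, by simp [ha], ha'⟩
  · beta_reduce
    split_ifs with hyx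
    · exact hHit (hyx ▸ hy)
    · refine ⟨⟨y, by simp, hy⟩, fun z _ hz => ?_⟩
      beta_reduce
      split_ifs with hzx
      · exact hAcc (hzx ▸ hz)
      · exact hRej

theorem NoneAfter.draw {n : ℕ} {A : Finset Ω} {onHit onAcc onRej : CondAlg Ω (Option R)}
    (hHit : onHit.NoneAfter (n - 1)) (hAcc : onAcc.NoneAfter (n - 1))
    (hRej : onRej.NoneAfter (n - 1)) : (draw x A onHit onAcc onRej).NoneAfter n := by
  intro y
  beta_reduce
  split_ifs
  · exact hHit
  · intro z
    beta_reduce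
    split_ifs
    · exact hAcc.mono (by omega)
    · exact hRej.mono (by omega)

end CondAlg
end Draw

/-! ### Averages over the random set -/

section Averages

variable {Ω : Type u} [Fintype Ω] (μ : PMF Ω) (x : Ω)

/-- The ratio of the acceptance mass of all elements other than `x` to the mass of `x`. -/
def acceptTotal : ℝ := acceptSum μ x Finset.univ

theorem acceptTotal_nonneg : 0 ≤ acceptTotal μ x := acceptSum_nonneg μ x _

open Classical in
theorem acceptSum_eq (A : Finset Ω) :
    acceptSum μ x A = ∑ y ∈ A, if y = x then 0 else accept μ x y := by
  rw [acceptSum, ← Finset.filter_ne', Finset.sum_filter]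
  refine Finset.sum_congr rfl fun y _ => ?_
  by_cases h : y = x <;> simp [h]

theorem sum_setWeight_acceptSum (α : ℝ) :
    ∑ A, setWeight α A * acceptSum μ x A = α * acceptTotal μ x := by
  classical
  simp_rw [acceptTotal, acceptSum_eq]
  exact sum_setWeight_mul_sum α _

theorem sum_setWeight_acceptSum_sq_le {α : ℝ} (h0 : 0 ≤ α) :
    ∑ A, setWeight α A * acceptSum μ x A ^ 2 ≤
      α * acceptTotal μ x + (α * acceptTotal μ x) ^ 2 := by
  classical
  simp_rw [acceptTotal, acceptSum_eq]
  refine sum_setWeight_mul_sq_le h0 (fun y => ?_) (fun y => ?_)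
  · split_ifs
    · exact le_rfl
    · exact accept_nonneg μ x y
  · split_ifs
    · exact zero_le_one
    · exact accept_le_one μ x y

/-- The average of `1 / (1 + X)` for a sum `X` with variance at most its mean. -/
theorem sum_setWeight_inv_acceptSum_le {α : ℝ} (h0 : 0 ≤ α) (h1 : α ≤ 1) :
    ∑ A, setWeight α A * (1 / (1 + acceptSum μ x A)) ≤ 2 / (1 + α * acceptTotal μ x) := by
  set m := α * acceptTotal μ x with hm
  have hm0 : 0 ≤ m := mul_nonneg h0 (acceptTotal_nonneg μ x)
  -- Second order expansion of `1 / (1 + X)` at the mean, with a remainder of the right sign.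
  have hX : ∀ A : Finset Ω, 1 / (1 + acceptSum μ x A) ≤
      1 / (1 + m) - (acceptSum μ x A - m) / (1 + m) ^ 2 +
        (acceptSum μ x A - m) ^ 2 / (1 + m) ^ 2 := by
    intro A
    have hX0 := acceptSum_nonneg μ x A
    set X := acceptSum μ x A
    have : 1 / (1 + X) = 1 / (1 + m) - (X - m) / (1 + m) ^ 2 +
        (X - m) ^ 2 / (1 + m) ^ 2 * (1 / (1 + X)) := by
      field_simp
      ring
    rw [this]
    gcongr
    refine mul_le_of_le_one_right (by positivity) ?_
    rw [div_le_one (by linarith)]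
    linarith
  have hid : ∀ A : Finset Ω, setWeight α A * (1 / (1 + m) - (acceptSum μ x A - m) / (1 + m) ^ 2 +
        (acceptSum μ x A - m) ^ 2 / (1 + m) ^ 2) =
      setWeight α A * (1 / (1 + m) + (m + m ^ 2) / (1 + m) ^ 2) +
        setWeight α A * acceptSum μ x A * (-(1 + 2 * m) / (1 + m) ^ 2) +
        setWeight α A * acceptSum μ x A ^ 2 * (1 / (1 + m) ^ 2) := by
    intro A; ring
  calc ∑ A, setWeight α A * (1 / (1 + acceptSum μ x A))
      ≤ ∑ A, setWeight α A * (1 / (1 + m) - (acceptSum μ x A - m) / (1 + m) ^ 2 +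
        (acceptSum μ x A - m) ^ 2 / (1 + m) ^ 2) :=
        Finset.sum_le_sum fun A _ =>
          mul_le_mul_of_nonneg_left (hX A) (setWeight_nonneg h0 h1 A)
    _ = 1 / (1 + m) + (m + m ^ 2) / (1 + m) ^ 2 + m * (-(1 + 2 * m) / (1 + m) ^ 2) +
          (∑ A, setWeight α A * acceptSum μ x A ^ 2) * (1 / (1 + m) ^ 2) := by
        simp_rw [hid]
        rw [Finset.sum_add_distrib, Finset.sum_add_distrib, ← Finset.sum_mul, ← Finset.sum_mul,
          ← Finset.sum_mul, sum_setWeight, sum_setWeight_acceptSum, one_mul]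
    _ ≤ 1 / (1 + m) + (m + m ^ 2) / (1 + m) ^ 2 + m * (-(1 + 2 * m) / (1 + m) ^ 2) +
          (m + m ^ 2) * (1 / (1 + m) ^ 2) := by
        gcongr
        exact sum_setWeight_acceptSum_sq_le μ x h0
    _ ≤ 2 / (1 + m) := by
        rw [← sub_nonneg]
        have : 2 / (1 + m) - (1 / (1 + m) + (m + m ^ 2) / (1 + m) ^ 2 +
          m * (-(1 + 2 * m) / (1 + m) ^ 2) + (m + m ^ 2) * (1 / (1 + m) ^ 2)) =
          1 / (1 + m) ^ 2 := by
          field_simp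
          ring
        rw [this]
        positivity

/-- The success probability of a comparison over the whole domain. -/
def hitTotal : ℝ := mass μ x * (1 + acceptTotal μ x)

variable {μ x}

theorem hitProb_univ : hitProb μ x Finset.univ = mass μ x := by
  classical
  rw [hitProb, Finset.insert_eq_of_mem (Finset.mem_univ x), sum_mass, div_one]

theorem hitTotal_pos (hx : 0 < mass μ x) : 0 < hitTotal μ x :=
  mul_pos hx (by linarith [acceptTotal_nonneg μ x])

theorem hitTotal_le_one (hx : 0 < mass μ x) : hitTotal μ x ≤ 1 := by
  have := hitProb_mul_le hx Finset.univ
  rwa [hitProb_univ] at this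

theorem sum_setWeight_hitProb_le (hx : 0 < mass μ x) {α : ℝ} (h0 : 0 ≤ α) (h1 : α ≤ 1) :
    ∑ A, setWeight α A * hitProb μ x A ≤ 2 / (1 + α * acceptTotal μ x) := by
  refine le_trans (Finset.sum_le_sum fun A _ => ?_) (sum_setWeight_inv_acceptSum_le μ x h0 h1)
  refine mul_le_mul_of_nonneg_left ?_ (setWeight_nonneg h0 h1 A)
  rw [le_div_iff₀ (by linarith [acceptSum_nonneg μ x A])]
  exact hitProb_mul_le hx A

open Classical in
theorem sum_setWeight_erase_le {α : ℝ} (h0 : 0 ≤ α) :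
    ∑ A, setWeight α A * ∑ y ∈ A.erase x, mass μ y ≤ α := by
  have h : ∀ A : Finset Ω, ∑ y ∈ A.erase x, mass μ y =
      ∑ y ∈ A, if y = x then 0 else mass μ y := by
    intro A
    rw [← Finset.filter_ne', Finset.sum_filter]
    refine Finset.sum_congr rfl fun y _ => ?_
    by_cases h : y = x <;> simp [h]
  simp_rw [h]
  rw [sum_setWeight_mul_sum]
  refine mul_le_of_le_one_right h0 ?_
  rw [← sum_mass μ]
  refine Finset.sum_le_sum fun y _ => ?_
  split_ifs
  · exact mass_nonneg μ y
  · exact le_rfl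

theorem sum_setWeight_inv_hitProb_le (hx : 0 < mass μ x) {α : ℝ} (h0 : 0 ≤ α) :
    ∑ A, setWeight α A * (1 / hitProb μ x A) ≤ 1 + α / mass μ x := by
  classical
  simp_rw [inv_hitProb hx, mul_add, mul_one, ← mul_div_assoc]
  rw [Finset.sum_add_distrib, sum_setWeight, ← Finset.sum_div]
  gcongr
  exact sum_setWeight_erase_le h0

theorem acceptTotal_le_card : 1 + acceptTotal μ x ≤ Fintype.card Ω := by
  classical
  have h : acceptTotal μ x ≤ ∑ _y ∈ Finset.univ.erase x, (1 : ℝ) :=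
    Finset.sum_le_sum fun y _ => accept_le_one μ x y
  rw [Finset.sum_const, Finset.card_erase_of_mem (Finset.mem_univ x), Finset.card_univ,
    nsmul_eq_mul, mul_one, Nat.cast_sub (Fintype.card_pos_iff.2 ⟨x⟩)] at h
  push_cast at h
  linarith

theorem mass_le_one : mass μ x ≤ 1 := by
  rw [← sum_mass μ]
  exact Finset.single_le_sum (fun y _ => mass_nonneg μ y) (Finset.mem_univ x)

end Averages

namespace CondAlg

variable {Ω : Type u}

/-! ### Sums of independent repetitions -/

/-- Thread an accumulator through `k` runs of `body`. -/
def iter (body : ℕ → CondAlg Ω (Option ℕ)) : ℕ → ℕ → CondAlg Ω (Option ℕ)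
  | 0, g => output (some g)
  | k + 1, g => (body g).obind (iter body k)

/-- If the increment of the accumulator has mean `m` and variance at most `v` in one run, in the
form of its second moments about all points, then it has mean `k m` and variance at most `k v`
in `k` runs. -/
theorem ev_iter_sq_le {O : Set Ω → PMF Ω} {body : ℕ → CondAlg Ω (Option ℕ)} {m v : ℝ} (hv : 0 ≤ v)
    (h : ∀ (g : ℕ) (b : ℝ), (body g).ev O (onSome fun g' : ℕ => ENNReal.ofReal ((g' + b) ^ 2)) ≤
      ENNReal.ofReal ((g + m + b) ^ 2 + v)) (k g : ℕ) (b : ℝ) :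
    (iter body k g).ev O (onSome fun g' : ℕ => ENNReal.ofReal ((g' + b) ^ 2)) ≤
      ENNReal.ofReal ((g + k * m + b) ^ 2 + k * v) := by
  induction k generalizing g with
  | zero => simp [iter, ev]
  | succ k ih =>
    rw [iter, ev_obind]
    calc (body g).ev O (onSome fun g' : ℕ => (iter body k g').ev O _)
        ≤ (body g).ev O (onSome fun g' : ℕ => ENNReal.ofReal ((g' + (k * m + b)) ^ 2) +
            ENNReal.ofReal (k * v)) := by
          refine ev_onSome_mono O (fun g' => (ih g').trans ?_) _
          rw [← ENNReal.ofReal_add (by positivity) (by positivity), add_assoc]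
      _ ≤ ENNReal.ofReal ((g + m + (k * m + b)) ^ 2 + v) + ENNReal.ofReal (k * v) := by
          rw [ev_onSome_add]
          exact add_le_add (h g _) (ev_onSome_const_le O _ _)
      _ = _ := by
          rw [← ENNReal.ofReal_add (by positivity) (by positivity)]
          congr 1
          push_cast
          ring

theorem cost_iter_le {O : Set Ω → PMF Ω} {body : ℕ → CondAlg Ω (Option ℕ)} {C : ℝ≥0∞}
    (h : ∀ g, (body g).cost O ≤ C) (k g : ℕ) : (iter body k g).cost O ≤ k * C := by
  induction k generalizing g with
  | zero => simp [iter, cost]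
  | succ k ih =>
    rw [iter, cost_obind]
    calc _ ≤ C + (body g).ev O (onSome fun _ => k * C) :=
          add_le_add (h g) (ev_onSome_mono O (fun r => ih r) _)
      _ ≤ C + k * C := by gcongr; exact ev_onSome_const_le O _ _
      _ = _ := by push_cast; ring

theorem NoneAfter.iter {n : ℕ} {body : ℕ → CondAlg Ω (Option ℕ)} (h : ∀ g, (body g).NoneAfter n)
    (k g : ℕ) : (iter body k g).NoneAfter n := by
  induction k generalizing g with
  | zero => exact fun h => by simp at h
  | succ k ih => exact (h g).obind ih

theorem Safe.iter {μ : PMF Ω} {P : Option ℕ → Prop} {body : ℕ → CondAlg Ω (Option ℕ)}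
    (hP : P none) (h : ∀ g, (body g).Safe μ P) {k g : ℕ} (hk : k ≠ 0) :
    (iter body k g).Safe μ P := by
  obtain ⟨k, rfl⟩ := Nat.exists_eq_succ_of_ne_zero hk
  induction k generalizing g with
  | zero =>
    refine (h g).bind fun o ho => ?_
    cases o with
    | none => exact hP
    | some r => exact ho
  | succ k ih =>
    refine (h g).bind fun o ho => ?_
    cases o with
    | none => exact hP
    | some r => exact ih (by omega)

open Classical in
/-- Chebyshev's inequality. -/
theorem ev_deviation_le {O : Set Ω → PMF Ω} {a : CondAlg Ω (Option ℕ)} {m v δ : ℝ} (hδ : 0 < δ)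
    (h : a.ev O (onSome fun g : ℕ => ENNReal.ofReal ((g + -m) ^ 2)) ≤ ENNReal.ofReal v) :
    a.ev O (onSome fun g : ℕ => if δ < |(g : ℝ) - m| then 1 else 0) ≤
      ENNReal.ofReal (v / δ ^ 2) := by
  calc _ ≤ a.ev O (onSome fun g : ℕ => ENNReal.ofReal (1 / δ ^ 2) *
        ENNReal.ofReal ((g + -m) ^ 2)) := by
        refine ev_onSome_mono O (fun g => ?_) a
        split_ifs with hg
        · rw [← ENNReal.ofReal_mul (by positivity), ← ENNReal.ofReal_one]
          apply ENNReal.ofReal_le_ofReal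
          rw [one_div_mul_eq_div, le_div_iff₀ (by positivity), one_mul, ← sub_eq_add_neg,
            ← sq_abs ((g : ℝ) - m)]
          gcongr
        · exact zero_le
    _ ≤ ENNReal.ofReal (1 / δ ^ 2) * ENNReal.ofReal v := by
        rw [ev_onSome_const_mul]
        gcongr
    _ = _ := by
        rw [← ENNReal.ofReal_mul (by positivity)]
        congr 1
        ring

/-! ### Waiting loops -/

section Loops

variable [Fintype Ω] {μ : PMF Ω} {O : Set Ω → PMF Ω} {x : Ω}

/-- Count, starting from `t`, the comparisons over the whole domain until one of them returns `x`,
giving up after `n` comparisons. -/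
def waitLoop (x : Ω) : ℕ → ℕ → CondAlg Ω (Option ℕ)
  | 0, _ => output none
  | n + 1, t => draw x Finset.univ (output (some (t + 1))) (output (some (t + 1)))
      (waitLoop x n (t + 1))

/-- Count, starting from `g`, the accepted elements among the samples conditioned on `A ∪ {x}`
before the first sample equal to `x`, giving up after `n` comparisons. -/
def countLoop (x : Ω) (A : Finset Ω) : ℕ → ℕ → CondAlg Ω (Option ℕ)
  | 0, _ => output none
  | n + 1, g => draw x A (output (some g)) (countLoop x A n (g + 1)) (countLoop x A n g)

/-- The waiting time is geometric. -/
theorem ev_waitLoop_sq_le (hO : IsCondOracle μ O) (hx : 0 < mass μ x) (n t : ℕ) (b : ℝ) :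
    (waitLoop x n t).ev O (onSome fun g : ℕ => ENNReal.ofReal ((g + b) ^ 2)) ≤
      ENNReal.ofReal ((t + 1 / hitTotal μ x + b) ^ 2 + 1 / hitTotal μ x ^ 2) := by
  have hp := hitTotal_pos hx
  have hp1 := hitTotal_le_one hx
  have key : (waitLoop x n t).ev O (onSome fun g : ℕ => ENNReal.ofReal ((g + b) ^ 2)) ≤
      ENNReal.ofReal ((t + 1 / hitTotal μ x + b) ^ 2 + (1 - hitTotal μ x) / hitTotal μ x ^ 2) := by
    induction n generalizing t with
    | zero => simp [waitLoop, ev]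
    | succ n ih =>
      rw [waitLoop]
      have h0 : (0 : ℝ) ≤ (1 - hitTotal μ x) / hitTotal μ x ^ 2 :=
        div_nonneg (by linarith) (by positivity)
      refine (ev_draw_le hO hx Finset.univ (u := ((t + 1 : ℕ) + b) ^ 2)
        (v := ((t + 1 : ℕ) + b) ^ 2)
        (w := ((t + 1 : ℕ) + 1 / hitTotal μ x + b) ^ 2 + (1 - hitTotal μ x) / hitTotal μ x ^ 2)
        (by positivity) (by positivity) (by positivity) le_rfl le_rfl (ih (t + 1))).trans ?_
      apply ENNReal.ofReal_le_ofReal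
      have e1 : hitProb μ x Finset.univ * acceptSum μ x Finset.univ =
          hitTotal μ x - hitProb μ x Finset.univ := by
        rw [hitProb_univ, hitTotal, acceptTotal]; ring
      rw [e1]
      apply le_of_eq
      push_cast
      field_simp
      ring
  refine key.trans (ENNReal.ofReal_le_ofReal ?_)
  gcongr
  linarith

theorem cost_waitLoop_le (hO : IsCondOracle μ O) (hx : 0 < mass μ x) (n t : ℕ) :
    (waitLoop x n t).cost O ≤ ENNReal.ofReal (2 / hitTotal μ x) := by
  have hp := hitTotal_pos hx
  induction n generalizing t with
  | zero => simp [waitLoop, cost]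
  | succ n ih =>
    rw [waitLoop]
    refine (cost_draw_le hO hx Finset.univ (u := 0) (v := 0) (w := 2 / hitTotal μ x) le_rfl le_rfl
      (by positivity) (by simp [cost]) (by simp [cost]) (ih _)).trans ?_
    apply ENNReal.ofReal_le_ofReal
    have e1 : hitProb μ x Finset.univ * acceptSum μ x Finset.univ =
        hitTotal μ x - hitProb μ x Finset.univ := by
      rw [hitProb_univ, hitTotal, acceptTotal]; ring
    rw [e1]
    apply le_of_eq
    field_simp
    ring

theorem NoneAfter.waitLoop (n t : ℕ) : (waitLoop x n t).NoneAfter n := by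
  induction n generalizing t with
  | zero => exact fun _ => rfl
  | succ n ih => exact NoneAfter.draw (fun h => by simp at h) (fun h => by simp at h) (ih _)

/-- A success of the waiting loop certifies that `x` has positive mass. -/
theorem Safe.waitLoop (n t : ℕ) :
    (waitLoop x n t).Safe μ fun o => o ≠ none → x ∈ μ.support := by
  induction n generalizing t with
  | zero => exact fun h => absurd rfl h
  | succ n ih =>
    obtain ⟨a, ha⟩ := μ.support_nonempty
    exact Safe.draw (Or.inr ⟨a, Finset.mem_univ a, ha⟩) (fun h _ => h) (fun h _ => h) (ih _)

/-- Bounds for the count from a superharmonic function: given `A`, the count is geometric with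
mean `acceptSum μ x A`. -/
theorem ev_countLoop_le (hO : IsCondOracle μ O) (hx : 0 < mass μ x) (A : Finset Ω) {φ Φ : ℕ → ℝ}
    (hφ : ∀ g, 0 ≤ φ g) (hΦ : ∀ g, 0 ≤ Φ g)
    (h : ∀ g, φ g + acceptSum μ x A * Φ (g + 1) ≤ (1 + acceptSum μ x A) * Φ g) (n g : ℕ) :
    (countLoop x A n g).ev O (onSome fun g : ℕ => ENNReal.ofReal (φ g)) ≤ ENNReal.ofReal (Φ g) := by
  induction n generalizing g with
  | zero => simp [countLoop, ev]
  | succ n ih =>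
    rw [countLoop]
    refine (ev_draw_le hO hx A (hφ g) (hΦ (g + 1)) (hΦ g) le_rfl (ih _) (ih _)).trans ?_
    apply ENNReal.ofReal_le_ofReal
    have hq := hitProb_pos hx A
    nlinarith [mul_le_mul_of_nonneg_left (h g) hq.le]

theorem cost_countLoop_le (hO : IsCondOracle μ O) (hx : 0 < mass μ x) (A : Finset Ω) (n g : ℕ) :
    (countLoop x A n g).cost O ≤ ENNReal.ofReal (2 * (1 / hitProb μ x A)) := by
  have hq := hitProb_pos hx A
  induction n generalizing g with
  | zero => simp [countLoop, cost]
  | succ n ih =>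
    rw [countLoop]
    refine (cost_draw_le hO hx A (u := 0) le_rfl (by positivity) (by positivity)
      (by simp [cost]) (ih _) (ih _)).trans ?_
    apply ENNReal.ofReal_le_ofReal
    apply le_of_eq
    field_simp
    ring

theorem NoneAfter.countLoop (A : Finset Ω) (n g : ℕ) : (countLoop x A n g).NoneAfter n := by
  induction n generalizing g with
  | zero => exact fun _ => rfl
  | succ n ih => exact NoneAfter.draw (fun h => by simp at h) (ih _) (ih _)

theorem Safe.countLoop (hx : x ∈ μ.support) (A : Finset Ω) (n g : ℕ) :
    (countLoop x A n g).Safe μ fun _ => True := by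
  induction n generalizing g with
  | zero => trivial
  | succ n ih =>
    exact Safe.draw (Or.inl hx) (fun _ => trivial) (fun _ => ih _) (ih _)

/-- The count in a fresh random set of level `i`. -/
def levelCount (x : Ω) (n i g : ℕ) : CondAlg Ω (Option ℕ) := tossSet i fun A => countLoop x A n g

theorem NoneAfter.levelCount (n i g : ℕ) : (levelCount x n i g).NoneAfter n :=
  fun _ => NoneAfter.countLoop _ _ _

theorem Safe.levelCount (hx : x ∈ μ.support) (n i g : ℕ) :
    (levelCount x n i g).Safe μ fun _ => True :=
  Safe.tossSet fun A => Safe.countLoop hx A n g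

theorem ev_levelCount_le (hO : IsCondOracle μ O) (hx : 0 < mass μ x) {φ : ℕ → ℝ}
    {Φ : Finset Ω → ℕ → ℝ} (hφ : ∀ g, 0 ≤ φ g) (hΦ : ∀ A g, 0 ≤ Φ A g)
    (h : ∀ A g, φ g + acceptSum μ x A * Φ A (g + 1) ≤ (1 + acceptSum μ x A) * Φ A g)
    (n i g : ℕ) :
    (levelCount x n i g).ev O (onSome fun g : ℕ => ENNReal.ofReal (φ g)) ≤
      ENNReal.ofReal (∑ A, setWeight (rate i) A * Φ A g) := by
  rw [levelCount, ev_tossSet]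
  exact sum_setWeight_ofReal_le i
    (fun A => ev_countLoop_le hO hx A hφ (hΦ A) (h A) n g) (fun A => hΦ A g)

theorem ev_levelCount_sq_le (hO : IsCondOracle μ O) (hx : 0 < mass μ x) (n i g : ℕ) (b : ℝ) :
    (levelCount x n i g).ev O (onSome fun g : ℕ => ENNReal.ofReal ((g + b) ^ 2)) ≤
      ENNReal.ofReal ((g + rate i * acceptTotal μ x + b) ^ 2 +
        ((rate i * acceptTotal μ x) ^ 2 + 3 * (rate i * acceptTotal μ x))) := by
  refine (ev_levelCount_le hO hx (Φ := fun A g => (g + b + acceptSum μ x A) ^ 2 +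
    (acceptSum μ x A ^ 2 + acceptSum μ x A)) (fun g => by positivity) (fun A g => ?_)
    (fun A g => ?_) n i g).trans (ENNReal.ofReal_le_ofReal ?_)
  · have := acceptSum_nonneg μ x A
    positivity
  · apply le_of_eq
    push_cast
    ring
  · set m := rate i * acceptTotal μ x with hm
    have hid : ∀ A : Finset Ω, setWeight (rate i) A * ((g + b + acceptSum μ x A) ^ 2 +
        (acceptSum μ x A ^ 2 + acceptSum μ x A)) =
        setWeight (rate i) A * (g + b) ^ 2 +
          setWeight (rate i) A * acceptSum μ x A * (2 * (g + b) + 1) +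
          setWeight (rate i) A * acceptSum μ x A ^ 2 * 2 := by
      intro A; ring
    simp_rw [hid]
    rw [Finset.sum_add_distrib, Finset.sum_add_distrib, ← Finset.sum_mul, ← Finset.sum_mul,
      ← Finset.sum_mul, sum_setWeight, sum_setWeight_acceptSum]
    have := sum_setWeight_acceptSum_sq_le μ x (rate_pos i).le
    rw [← hm] at this ⊢
    nlinarith

/-- The count is zero with small probability at a high density. -/
theorem ev_levelCount_zero_le (hO : IsCondOracle μ O) (hx : 0 < mass μ x) (n i : ℕ) :
    (levelCount x n i 0).ev O (onSome fun g : ℕ => if g = 0 then 1 else 0) ≤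
      ENNReal.ofReal (2 / (1 + rate i * acceptTotal μ x)) := by
  have h := ev_levelCount_le hO hx (φ := fun g => if g = 0 then 1 else 0)
    (Φ := fun A g => if g = 0 then 1 / (1 + acceptSum μ x A) else 0)
    (fun g => by split_ifs <;> simp) (fun A g => ?_) (fun A g => ?_) n i 0
  · calc _ = (levelCount x n i 0).ev O
          (onSome fun g : ℕ => ENNReal.ofReal (if g = 0 then 1 else 0)) := by
          congr 2
          funext g
          split_ifs <;> simp
      _ ≤ _ := h
      _ ≤ _ := ENNReal.ofReal_le_ofReal
        (by simpa using sum_setWeight_inv_acceptSum_le μ x (rate_pos i).le (rate_le_one i))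
  · have := acceptSum_nonneg μ x A
    split_ifs <;> positivity
  · have := acceptSum_nonneg μ x A
    by_cases hg : g = 0
    · simp only [hg, if_true, zero_add, one_ne_zero, if_false, mul_zero, add_zero]
      rw [mul_one_div_cancel (by positivity)]
    · simp [hg]

/-- The count is positive with small probability at a low density. -/
theorem ev_levelCount_pos_le (hO : IsCondOracle μ O) (hx : 0 < mass μ x) (n i : ℕ) :
    (levelCount x n i 0).ev O (onSome fun g : ℕ => if g = 0 then 0 else 1) ≤
      ENNReal.ofReal (rate i * acceptTotal μ x) := by
  have h := ev_levelCount_le hO hx (φ := fun g => (g : ℝ))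
    (Φ := fun A g => g + acceptSum μ x A) (fun g => by positivity) (fun A g => ?_)
    (fun A g => ?_) n i 0
  · refine le_trans (ev_onSome_mono O (fun g => ?_) _) (h.trans (ENNReal.ofReal_le_ofReal ?_))
    · split_ifs with hg
      · exact zero_le
      · rw [ENNReal.ofReal_natCast]
        exact_mod_cast Nat.one_le_iff_ne_zero.2 hg
    · simp [sum_setWeight_acceptSum]
  · have := acceptSum_nonneg μ x A
    positivity
  · apply le_of_eq
    push_cast
    ring

theorem cost_levelCount_le (hO : IsCondOracle μ O) (hx : 0 < mass μ x) (n i g : ℕ) :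
    (levelCount x n i g).cost O ≤ ENNReal.ofReal (2 * (1 + rate i / mass μ x)) := by
  rw [levelCount, cost_tossSet]
  refine (sum_setWeight_ofReal_le i (fun A => cost_countLoop_le hO hx A n g) (fun A => ?_)).trans
    (ENNReal.ofReal_le_ofReal ?_)
  · have := hitProb_pos hx A
    positivity
  · simp_rw [mul_left_comm _ (2 : ℝ)]
    rw [← Finset.mul_sum]
    gcongr
    exact sum_setWeight_inv_hitProb_le hx (rate_pos i).le

end Loops

end CondAlg

/-! ### Geometric sums over levels -/

theorem sum_filter_rate_le {P : ℕ → Prop} [DecidablePred P] {t : ℝ} (ht : 0 ≤ t)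
    (hP : ∀ r, P r → rate r ≤ t) (n : ℕ) :
    ∑ r ∈ Finset.range n, (if P r then rate r else 0) ≤ 2 * t := by
  have key : (∑ r ∈ Finset.range n, if P r then rate r else 0) = 0 ∨
      (∑ r ∈ Finset.range n, if P r then rate r else 0) + 2 * rate n ≤ 2 * t := by
    induction n with
    | zero => simp
    | succ n ih =>
      rw [Finset.sum_range_succ, rate_succ]
      by_cases h : P n
      · have := hP n h
        right
        rcases ih with ih | ih
        · rw [ih, if_pos h]; linarith
        · rw [if_pos h]; linarith
      · rw [if_neg h, add_zero]
        have := rate_pos n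
        exact ih.imp id fun ih => by linarith
  rcases key with h | h
  · rw [h]; linarith
  · linarith [rate_pos n]

theorem sum_filter_inv_rate_le {P : ℕ → Prop} [DecidablePred P] {t : ℝ} (ht : 0 ≤ t)
    (hP : ∀ r, P r → 1 / rate r ≤ t) (n : ℕ) :
    ∑ r ∈ Finset.range n, (if P r then 1 / rate r else 0) ≤ 2 * t := by
  have key : (∑ r ∈ Finset.range n, if P r then 1 / rate r else 0) ≤ 1 / rate n ∧
      (∑ r ∈ Finset.range n, if P r then 1 / rate r else 0) ≤ 2 * t := by
    induction n with
    | zero => simpa [rate_zero] using ht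
    | succ n ih =>
      rw [Finset.sum_range_succ, rate_succ]
      have h2 : 1 / (rate n / 2) = 1 / rate n + 1 / rate n := by ring
      have hn : 0 < 1 / rate n := one_div_pos.2 (rate_pos n)
      rw [h2]
      by_cases h : P n
      · have := hP n h
        rw [if_pos h]
        constructor <;> linarith [ih.1]
      · rw [if_neg h, add_zero]
        exact ⟨by linarith [ih.1], ih.2⟩
  exact key.2

theorem tsum_filter_rate_le {P : ℕ → Prop} [DecidablePred P] {t : ℝ} (ht : 0 ≤ t)
    (hP : ∀ r, P r → rate r ≤ t) :
    ∑' r, (if P r then ENNReal.ofReal (rate r) else 0) ≤ ENNReal.ofReal (2 * t) := by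
  refine ENNReal.tsum_le_of_sum_range_le fun n => ?_
  refine le_trans (le_of_eq ?_) (ENNReal.ofReal_le_ofReal (sum_filter_rate_le ht hP n))
  rw [ENNReal.ofReal_sum_of_nonneg fun r _ => by split_ifs; exacts [(rate_pos r).le, le_rfl]]
  refine Finset.sum_congr rfl fun r _ => ?_
  split_ifs <;> simp

theorem tsum_filter_inv_rate_le {P : ℕ → Prop} [DecidablePred P] {t : ℝ} (ht : 0 ≤ t)
    (hP : ∀ r, P r → 1 / rate r ≤ t) :
    ∑' r, (if P r then ENNReal.ofReal (1 / rate r) else 0) ≤ ENNReal.ofReal (2 * t) := by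
  refine ENNReal.tsum_le_of_sum_range_le fun n => ?_
  refine le_trans (le_of_eq ?_) (ENNReal.ofReal_le_ofReal (sum_filter_inv_rate_le ht hP n))
  rw [ENNReal.ofReal_sum_of_nonneg fun r _ => by
    split_ifs; exacts [(one_div_pos.2 (rate_pos r)).le, le_rfl]]
  refine Finset.sum_congr rfl fun r _ => ?_
  split_ifs <;> simp

namespace CondAlg

variable {Ω : Type u} [Fintype Ω] {μ : PMF Ω} {O : Set Ω → PMF Ω} {x : Ω}

/-! ### Binary search for the level -/

open Classical in
/-- Is a sample conditioned on `A ∪ {x}`, for a fresh random set `A` of level `i`, equal to `x`? -/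
def probe (x : Ω) (i : ℕ) : CondAlg Ω Bool :=
  tossSet i fun A => sample ((insert x A : Finset Ω) : Set Ω) fun y => output (decide (y = x))

/-- Do two independent probes both return `x`? -/
def test (x : Ω) (i : ℕ) : CondAlg Ω Bool :=
  (probe x i).bind fun b => if b then probe x i else output false

/-- Binary search among the levels `lo, …, lo + 2 ^ d - 1`. A failed test moves the search to the
larger levels, that is, to the sparser sets. -/
def search (x : Ω) : ℕ → ℕ → CondAlg Ω ℕ
  | 0, lo => output lo
  | d + 1, lo => (test x (lo + 2 ^ d)).bind fun b =>
      if b then search x d lo else search x d (lo + 2 ^ d)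

theorem ev_probe_true_le (hO : IsCondOracle μ O) (hx : 0 < mass μ x) (i : ℕ) :
    (probe x i).ev O (fun b => if b then 1 else 0) ≤
      ENNReal.ofReal (2 / (1 + rate i * acceptTotal μ x)) := by
  classical
  rw [probe, ev_tossSet]
  refine (sum_setWeight_ofReal_le i (h := hitProb μ x) (fun A => ?_)
    (fun A => (hitProb_pos hx A).le)).trans
    (ENNReal.ofReal_le_ofReal (sum_setWeight_hitProb_le hx (rate_pos i).le (rate_le_one i)))
  refine (tsum_oracle_le hO (sum_insert_mass_pos hx A) (h := fun y => if y = x then 1 else 0)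
    (fun y _ => ?_) (fun y _ => ?_)).trans (le_of_eq ?_)
  · by_cases h : y = x <;> simp [ev, h]
  · split_ifs <;> simp
  · simp [hitProb]

theorem ev_probe_false_le (hO : IsCondOracle μ O) (hx : 0 < mass μ x) (i : ℕ) :
    (probe x i).ev O (fun b => if b then 0 else 1) ≤ ENNReal.ofReal (rate i / mass μ x) := by
  classical
  rw [probe, ev_tossSet]
  refine (sum_setWeight_ofReal_le i (h := fun A => (∑ y ∈ A.erase x, mass μ y) / mass μ x)
    (fun A => ?_) (fun A => ?_)).trans (ENNReal.ofReal_le_ofReal ?_)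
  · refine (tsum_oracle_le hO (sum_insert_mass_pos hx A) (h := fun y => if y = x then 0 else 1)
      (fun y _ => ?_) (fun y _ => ?_)).trans (ENNReal.ofReal_le_ofReal ?_)
    · by_cases h : y = x <;> simp [ev, h]
    · split_ifs <;> simp
    · have h1 : ∑ y ∈ insert x A, mass μ y * (if y = x then 0 else 1) =
          ∑ y ∈ A.erase x, mass μ y := by
        rw [← Finset.insert_erase (Finset.mem_insert_self x A), Finset.sum_insert (by simp),
          Finset.erase_insert_eq_erase, if_pos rfl, mul_zero, zero_add]
        refine Finset.sum_congr rfl fun y hy => ?_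
        rw [if_neg (Finset.ne_of_mem_erase hy), mul_one]
      have h0 := Finset.sum_nonneg (s := A.erase x) fun y _ => mass_nonneg μ y
      rw [h1, sum_insert_mass_eq]
      gcongr
      linarith
  · exact div_nonneg (Finset.sum_nonneg fun y _ => mass_nonneg μ y) hx.le
  · simp_rw [← mul_div_assoc]
    rw [← Finset.sum_div]
    gcongr
    exact sum_setWeight_erase_le (rate_pos i).le

theorem ev_test_true_le (hO : IsCondOracle μ O) (hx : 0 < mass μ x) (i : ℕ) :
    (test x i).ev O (fun b => if b then 1 else 0) ≤
      ENNReal.ofReal ((2 / (1 + rate i * acceptTotal μ x)) ^ 2) := by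
  have h := ev_probe_true_le hO hx i
  have h0 : 0 ≤ 2 / (1 + rate i * acceptTotal μ x) := by
    have := mul_nonneg (rate_pos i).le (acceptTotal_nonneg μ x)
    positivity
  rw [test, ev_bind, sq, ENNReal.ofReal_mul h0]
  refine le_trans ?_ (mul_le_mul' h h)
  rw [← ev_const_mul]
  refine ev_mono O (fun b => ?_) _
  cases b <;> simp [ev]

theorem ev_test_false_le (hO : IsCondOracle μ O) (hx : 0 < mass μ x) (i : ℕ) :
    (test x i).ev O (fun b => if b then 0 else 1) ≤ ENNReal.ofReal (2 * (rate i / mass μ x)) := by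
  have h := ev_probe_false_le hO hx i
  have h0 : 0 ≤ rate i / mass μ x := div_nonneg (rate_pos i).le hx.le
  rw [test, ev_bind, two_mul, ENNReal.ofReal_add h0 h0]
  refine le_trans ?_ (add_le_add (ev_const O _ (probe x i)).le h)
  rw [← ev_add]
  refine ev_mono O (fun b => ?_) _
  cases b
  · simp [ev]
  · simpa using h

theorem cost_probe (i : ℕ) : (probe x i).cost O = 1 := by
  rw [probe, cost_tossSet]
  have h := PMF.tsum_coe (randSet (Ω := Ω) i)
  rw [tsum_fintype] at h
  simpa [cost, randSet] using h

theorem cost_search_le (d lo : ℕ) : (search x d lo).cost O ≤ 2 * d := by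
  induction d generalizing lo with
  | zero => simp [search, cost]
  | succ d ih =>
    have h1 : (test x (lo + 2 ^ d)).cost O ≤ 2 := by
      rw [test, cost_bind, cost_probe]
      refine (add_le_add le_rfl ((ev_mono O (g := fun _ => 1) (fun b => ?_) _).trans
        (ev_const O 1 _).le)).trans one_add_one_eq_two.le
      cases b <;> simp [cost_probe, cost]
    rw [search, cost_bind]
    calc _ ≤ 2 + (test x (lo + 2 ^ d)).ev O (fun _ => 2 * (d : ℝ≥0∞)) := by
          refine add_le_add h1 (ev_mono O (fun b => ?_) _)
          cases b
          · exact ih _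
          · exact ih _
      _ = _ := by
          rw [ev_const]
          push_cast
          ring

theorem ev_search_eq_zero_of_le {r : ℕ} (d lo : ℕ) (h : lo + 2 ^ d ≤ r) :
    (search x d lo).ev O (fun i => if i = r then 1 else 0) = 0 := by
  induction d generalizing lo with
  | zero =>
    have : lo ≠ r := by
      rw [pow_zero] at h
      omega
    simp [search, ev, this]
  | succ d ih =>
    have h2 := Nat.zero_le (2 ^ d)
    rw [pow_succ] at h
    rw [search, ev_bind]
    refine le_antisymm ((ev_mono O (fun b => ?_) _).trans (ev_const O 0 _).le) zero_le
    cases b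
    · exact (ih (lo + 2 ^ d) (by omega)).le
    · exact (ih lo (by omega)).le

theorem ev_search_eq_zero_of_lt {r : ℕ} (d lo : ℕ) (h : r < lo) :
    (search x d lo).ev O (fun i => if i = r then 1 else 0) = 0 := by
  induction d generalizing lo with
  | zero => simp [search, ev, h.ne']
  | succ d ih =>
    rw [search, ev_bind]
    refine le_antisymm ((ev_mono O (fun b => ?_) _).trans (ev_const O 0 _).le) zero_le
    cases b
    · exact (ih (lo + 2 ^ d) (Nat.lt_add_right _ h)).le
    · exact (ih lo h).le

/-- A result other than the left end was the place of a failed test. -/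
theorem ev_search_le_test_false (r d lo : ℕ) (h : r ≠ lo) :
    (search x d lo).ev O (fun i => if i = r then 1 else 0) ≤
      (test x r).ev O (fun b => if b then 0 else 1) := by
  induction d generalizing lo with
  | zero => simp [search, ev, h.symm]
  | succ d ih =>
    rw [search, ev_bind]
    by_cases hr : r = lo + 2 ^ d
    · have hle := ev_search_eq_zero_of_le (O := O) (x := x) d lo hr.ge
      rw [← hr]
      refine ev_mono O (fun b => ?_) _
      cases b
      · refine (ev_mono O (g := fun _ => 1) (fun i => ?_) _).trans (ev_const O 1 _).le
        split_ifs <;> simp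
      · simpa using hle.le
    · refine (ev_mono O (fun b => ?_) _).trans (ev_const O _ _).le
      cases b
      · exact ih _ hr
      · exact ih _ h

/-- If the result `r` is not at the right end, then the test at `r + 1` succeeded. -/
theorem ev_search_le_test_true (r d lo : ℕ) (h : r + 1 ≠ lo + 2 ^ d) :
    (search x d lo).ev O (fun i => if i = r then 1 else 0) ≤
      (test x (r + 1)).ev O (fun b => if b then 1 else 0) := by
  induction d generalizing lo with
  | zero =>
    have : lo ≠ r := fun h' => h (by simp [h'])
    simp [search, ev, this]
  | succ d ih =>
    rw [search, ev_bind]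
    by_cases hr : r + 1 = lo + 2 ^ d
    · have hle := ev_search_eq_zero_of_lt (O := O) (x := x) d (lo + 2 ^ d) (r := r) (by omega)
      rw [hr]
      refine ev_mono O (fun b => ?_) _
      cases b
      · simpa using hle.le
      · refine (ev_mono O (g := fun _ => 1) (fun i => ?_) _).trans (ev_const O 1 _).le
        split_ifs <;> simp
    · refine (ev_mono O (fun b => ?_) _).trans (ev_const O _ _).le
      cases b
      · refine ih _ ?_
        rw [pow_succ] at h
        omega
      · exact ih _ hr

open Classical in
/-- The density found by the search is at most of the order at which the random set has the
acceptance mass of `x`. -/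
theorem ev_search_rate_le (hO : IsCondOracle μ O) (hx : 0 < mass μ x) {d : ℕ}
    (hd : Fintype.card Ω ≤ 2 ^ (2 ^ d - 1)) :
    (search x d 0).ev O (fun i => ENNReal.ofReal (rate i)) ≤
      ENNReal.ofReal (33 / (1 + acceptTotal μ x)) := by
  have hR := acceptTotal_nonneg μ x
  set t := 1 / (1 + acceptTotal μ x) with ht
  have ht0 : 0 < t := by positivity
  have hlast : rate (2 ^ d - 1) ≤ t := by
    have h1 : 1 + acceptTotal μ x ≤ 2 ^ (2 ^ d - 1) :=
      (acceptTotal_le_card).trans (by exact_mod_cast hd)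
    rw [rate, ht, one_div_pow]
    exact one_div_le_one_div_of_le (by linarith) h1
  calc (search x d 0).ev O (fun i => ENNReal.ofReal (rate i))
      ≤ (search x d 0).ev O (fun i => ENNReal.ofReal t + ∑' r,
          (if t < rate r then ENNReal.ofReal (rate r) else 0) * if i = r then 1 else 0) := by
        refine ev_mono O (fun i => ?_) _
        rw [tsum_eq_single i (by intro r hr; simp [hr.symm])]
        by_cases h : t < rate i
        · simp [h]
        · simpa [h] using ENNReal.ofReal_le_ofReal (not_lt.1 h)
    _ ≤ ENNReal.ofReal t + ∑' r, ENNReal.ofReal (16 * t ^ 2) *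
          (if t < rate r then ENNReal.ofReal (1 / rate r) else 0) := by
        rw [ev_add, ev_const, ev_tsum]
        refine add_le_add le_rfl (ENNReal.tsum_le_tsum fun r => ?_)
        rw [ev_const_mul]
        split_ifs with hr
        · have hne : r + 1 ≠ 0 + 2 ^ d := by
            intro h
            have : r = 2 ^ d - 1 := by omega
            rw [this] at hr
            linarith
          refine (mul_le_mul' le_rfl ((ev_search_le_test_true r d 0 hne).trans
            (ev_test_true_le hO hx (r + 1)))).trans ?_
          have hr0 := rate_pos r
          have hr1 := rate_le_one r
          rw [← ENNReal.ofReal_mul hr0.le, ← ENNReal.ofReal_mul (by positivity)]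
          apply ENNReal.ofReal_le_ofReal
          have h2 : 2 / (1 + rate (r + 1) * acceptTotal μ x) ≤ 4 * t / rate r := by
            rw [ht, rate_succ, div_le_div_iff₀ (by positivity) hr0]
            field_simp
            nlinarith
          calc rate r * (2 / (1 + rate (r + 1) * acceptTotal μ x)) ^ 2
              ≤ rate r * (4 * t / rate r) ^ 2 := by
                have := rate_pos (r + 1)
                gcongr
            _ = 16 * t ^ 2 * (1 / rate r) := by field_simp; ring
        · simp
    _ ≤ ENNReal.ofReal t + ENNReal.ofReal (16 * t ^ 2) * ENNReal.ofReal (2 * (1 / t)) := by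
        rw [ENNReal.tsum_mul_left]
        gcongr
        refine tsum_filter_inv_rate_le (by positivity) fun r hr => ?_
        exact one_div_le_one_div_of_le ht0 hr.le
    _ = _ := by
        rw [← ENNReal.ofReal_mul (by positivity), ← ENNReal.ofReal_add ht0.le (by positivity)]
        congr 1
        rw [ht]
        field_simp
        ring

open Classical in
/-- The number of levels up to `i` with density less than the mass of `x`. -/
def excess (μ : PMF Ω) (x : Ω) : ℕ → ℕ
  | 0 => 0
  | i + 1 => excess μ x i + if rate (i + 1) < mass μ x then 1 else 0

open Classical in
theorem excess_eq_tsum (i : ℕ) : (excess μ x i : ℝ≥0∞) =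
    ∑' j, if rate j < mass μ x then if j ≤ i then 1 else 0 else 0 := by
  rw [tsum_eq_sum (s := Finset.range (i + 1))]
  · induction i with
    | zero => simp [excess, rate_zero, mass_le_one]
    | succ i ih =>
      rw [Finset.sum_range_succ, excess, Nat.cast_add, ih]
      congr 1
      · refine Finset.sum_congr rfl fun j hj => ?_
        have := Finset.mem_range.1 hj
        rw [if_pos (by omega : j ≤ i), if_pos (by omega : j ≤ i + 1)]
      · split_ifs <;> simp_all
  · intro j hj
    have : ¬ j ≤ i := fun h => hj (Finset.mem_range.2 (by omega))
    simp [this]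

open Classical in
/-- The search passes the level of `x` by a bounded number of steps on average. -/
theorem ev_search_excess_le (hO : IsCondOracle μ O) (hx : 0 < mass μ x) (d : ℕ) :
    (search x d 0).ev O (fun i => (excess μ x i : ℝ≥0∞)) ≤ ENNReal.ofReal 8 := by
  simp_rw [excess_eq_tsum]
  rw [ev_tsum]
  calc ∑' j, (search x d 0).ev O
        (fun i => if rate j < mass μ x then if j ≤ i then 1 else 0 else 0)
      ≤ ∑' j, ENNReal.ofReal (4 / mass μ x) *
          if rate j < mass μ x then ENNReal.ofReal (rate j) else 0 := by
        refine ENNReal.tsum_le_tsum fun j => ?_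
        by_cases hj : rate j < mass μ x
        · have hj0 : j ≠ 0 := by
            rintro rfl
            rw [rate_zero] at hj
            linarith [mass_le_one (μ := μ) (x := x)]
          simp only [hj, if_true]
          calc (search x d 0).ev O (fun i => if j ≤ i then 1 else 0)
              ≤ (search x d 0).ev O (fun i => ∑' r,
                  (if j ≤ r then 1 else 0) * if i = r then 1 else 0) := by
                refine ev_mono O (fun i => ?_) _
                rw [tsum_eq_single i (by intro r hr; simp [hr.symm])]
                simp
            _ ≤ ∑' r, ENNReal.ofReal (2 / mass μ x) *
                  if j ≤ r then ENNReal.ofReal (rate r) else 0 := by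
                rw [ev_tsum]
                refine ENNReal.tsum_le_tsum fun r => ?_
                rw [ev_const_mul]
                split_ifs with hr
                · rw [one_mul, ← ENNReal.ofReal_mul (by positivity)]
                  refine (ev_search_le_test_false r d 0 (by omega)).trans
                    ((ev_test_false_le hO hx r).trans (ENNReal.ofReal_le_ofReal ?_))
                  apply le_of_eq
                  ring
                · simp
            _ ≤ ENNReal.ofReal (2 / mass μ x) * ENNReal.ofReal (2 * rate j) := by
                rw [ENNReal.tsum_mul_left]
                gcongr
                refine tsum_filter_rate_le (rate_pos j).le fun r hr => ?_
                exact pow_le_pow_of_le_one (by norm_num) (by norm_num) hr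
            _ = _ := by
                rw [← ENNReal.ofReal_mul (by positivity), ← ENNReal.ofReal_mul (by positivity)]
                congr 1
                ring
        · simp only [hj, if_false]
          rw [ev_const]
          exact zero_le
    _ ≤ ENNReal.ofReal (4 / mass μ x) * ENNReal.ofReal (2 * mass μ x) := by
        rw [ENNReal.tsum_mul_left]
        gcongr
        exact tsum_filter_rate_le hx.le fun r hr => hr.le
    _ = _ := by
        rw [← ENNReal.ofReal_mul (by positivity)]
        congr 1
        field_simp
        norm_num

theorem Safe.probe (hx : x ∈ μ.support) (i : ℕ) : (probe x i).Safe μ fun _ => True :=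
  Safe.tossSet fun _ => ⟨⟨x, by simp, hx⟩, fun _ _ _ => trivial⟩

theorem Safe.search (hx : x ∈ μ.support) (d lo : ℕ) : (search x d lo).Safe μ fun _ => True := by
  induction d generalizing lo with
  | zero => trivial
  | succ d ih =>
    have ht : (test x (lo + 2 ^ d)).Safe μ fun _ => True := by
      refine (Safe.probe hx _).bind fun b _ => ?_
      cases b
      · trivial
      · exact Safe.probe hx _
    refine ht.bind fun b _ => ?_
    cases b
    · exact ih _
    · exact ih _

/-! ### Scanning towards denser sets -/

/-- Starting at level `i`, pass to denser random sets until one yields an accepted element before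
`x`; level `0` is accepted without a test. -/
def scan (x : Ω) (n : ℕ) : ℕ → CondAlg Ω (Option ℕ)
  | 0 => output (some 0)
  | i + 1 => (levelCount x n (i + 1) 0).obind fun g =>
      if g = 0 then scan x n i else output (some (i + 1))

theorem NoneAfter.scan (n i : ℕ) : (scan x n i).NoneAfter n := by
  induction i with
  | zero => exact fun h => by simp at h
  | succ i ih =>
    refine (NoneAfter.levelCount n _ _).obind fun g => ?_
    split_ifs
    · exact ih
    · exact fun h => by simp at h

theorem Safe.scan (hx : x ∈ μ.support) (n i : ℕ) : (scan x n i).Safe μ fun _ => True := by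
  induction i with
  | zero => trivial
  | succ i ih =>
    refine (Safe.levelCount hx n _ _).bind fun o _ => ?_
    cases o with
    | none => trivial
    | some g =>
      simp only [Option.elim_some]
      split_ifs
      · exact ih
      · trivial

theorem ev_scan_succ (f : ℕ → ℝ≥0∞) (n i : ℕ) :
    (scan x n (i + 1)).ev O (onSome f) =
      (scan x n i).ev O (onSome f) *
          (levelCount x n (i + 1) 0).ev O (onSome fun g : ℕ => if g = 0 then 1 else 0) +
        f (i + 1) *
          (levelCount x n (i + 1) 0).ev O (onSome fun g : ℕ => if g = 0 then 0 else 1) := by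
  rw [scan, ev_obind, ← ev_onSome_const_mul, ← ev_onSome_const_mul, ← ev_onSome_add]
  congr 2
  funext g
  split_ifs <;> simp [ev]

theorem cost_scan_succ (n i : ℕ) :
    (scan x n (i + 1)).cost O = (levelCount x n (i + 1) 0).cost O + (scan x n i).cost O *
      (levelCount x n (i + 1) 0).ev O (onSome fun g : ℕ => if g = 0 then 1 else 0) := by
  rw [scan, cost_obind, ← ev_onSome_const_mul]
  congr 3
  funext g
  split_ifs <;> simp [cost]

theorem ev_indicator_le_one {R : Type} (a : CondAlg Ω (Option R)) {p : R → Prop}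
    [DecidablePred p] : a.ev O (onSome fun g => if p g then 1 else 0) ≤ 1 := by
  refine (ev_onSome_mono O (g := fun _ => 1) (fun g => ?_) a).trans (ev_onSome_const_le O 1 a)
  split_ifs <;> simp

/-- A bound for the total density of the levels visited by a scan from level `i`, where `R` is the
total relative acceptance mass. -/
def scanRate (R : ℝ) : ℕ → ℝ
  | 0 => 1
  | i + 1 => rate (i + 1) + min 1 (2 / (1 + rate (i + 1) * R)) * scanRate R i

theorem scanRate_nonneg {R : ℝ} (hR : 0 ≤ R) (i : ℕ) : 0 ≤ scanRate R i := by
  induction i with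
  | zero => exact zero_le_one
  | succ i ih =>
    have := rate_pos (i + 1)
    rw [scanRate]
    positivity

theorem scanRate_le {R : ℝ} (hR : 0 ≤ R) (i : ℕ) :
    scanRate R i ≤ 48 / (1 + R) + 2 * rate i := by
  -- In the sparse range the visited densities form a geometric series. In the dense range the scan
  -- continues with probability at most `1 / 4`, while the density doubles.
  have key : (rate i * R < 7 → scanRate R i ≤ 48 / (1 + R) - rate i) ∧
      (7 ≤ rate i * R → scanRate R i ≤ 2 * rate i) := by
    induction i with
    | zero =>
      rw [rate_zero, scanRate]
      refine ⟨fun h => ?_, fun _ => by norm_num⟩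
      rw [le_sub_iff_add_le, le_div_iff₀ (by linarith)]
      linarith
    | succ i ih =>
      have hU := scanRate_nonneg hR i
      have hr := rate_pos i
      have hr1 := rate_le_one i
      rw [scanRate, rate_succ]
      constructor
      · intro h
        have hmin : min 1 (2 / (1 + rate i / 2 * R)) * scanRate R i ≤ scanRate R i :=
          mul_le_of_le_one_left hU (min_le_left _ _)
        rcases lt_or_ge (rate i * R) 7 with h7 | h7
        · linarith [ih.1 h7]
        · have h48 : 3 * rate i ≤ 48 / (1 + R) := by
            rw [le_div_iff₀ (by linarith)]
            nlinarith
          linarith [ih.2 h7]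
      · intro h
        have hmin : min 1 (2 / (1 + rate i / 2 * R)) ≤ 1 / 4 := by
          refine (min_le_right _ _).trans ?_
          rw [div_le_div_iff₀ (by linarith) (by norm_num)]
          linarith
        have := ih.2 (by linarith)
        nlinarith
  have hr := rate_pos i
  rcases lt_or_ge (rate i * R) 7 with h | h
  · linarith [key.1 h]
  · have : 0 ≤ 48 / (1 + R) := by positivity
    linarith [key.2 h]

theorem ev_levelCount_zero_le_min (hO : IsCondOracle μ O) (hx : 0 < mass μ x) (n i : ℕ) :
    (levelCount x n i 0).ev O (onSome fun g : ℕ => if g = 0 then 1 else 0) ≤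
      ENNReal.ofReal (min 1 (2 / (1 + rate i * acceptTotal μ x))) := by
  rw [ENNReal.ofReal_min, ENNReal.ofReal_one]
  exact le_min (ev_indicator_le_one _) (ev_levelCount_zero_le hO hx n i)

theorem ev_scan_rate_le (hO : IsCondOracle μ O) (hx : 0 < mass μ x) (n i : ℕ) :
    (scan x n i).ev O (onSome fun j : ℕ => ENNReal.ofReal (rate j)) ≤
      ENNReal.ofReal (scanRate (acceptTotal μ x) i) := by
  have hR := acceptTotal_nonneg μ x
  induction i with
  | zero => simp [scan, ev, scanRate, rate_zero]
  | succ i ih =>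
    have hr := rate_pos (i + 1)
    have hm : 0 ≤ min 1 (2 / (1 + rate (i + 1) * acceptTotal μ x)) := by positivity
    rw [ev_scan_succ, scanRate, add_comm, ENNReal.ofReal_add hr.le
      (mul_nonneg hm (scanRate_nonneg hR i)), ENNReal.ofReal_mul hm,
      mul_comm (ENNReal.ofReal (min _ _))]
    refine add_le_add ?_ (mul_le_mul' ih (ev_levelCount_zero_le_min hO hx n (i + 1)))
    refine mul_le_of_le_one_right zero_le (le_trans (ev_onSome_mono O (g := fun _ => 1)
      (fun g => ?_) _) (ev_onSome_const_le O 1 _))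
    split_ifs <;> simp

theorem cost_scan_le (hO : IsCondOracle μ O) (hx : 0 < mass μ x) (n i : ℕ) :
    (scan x n i).cost O ≤ ENNReal.ofReal
      (4 * (scanRate (acceptTotal μ x) i / mass μ x) + 2 * excess μ x i) := by
  have hR := acceptTotal_nonneg μ x
  induction i with
  | zero => simp [scan, cost]
  | succ i ih =>
    have hr := rate_pos (i + 1)
    have hU := scanRate_nonneg hR i
    have hm : 0 ≤ min 1 (2 / (1 + rate (i + 1) * acceptTotal μ x)) := by positivity
    have hm1 : min 1 (2 / (1 + rate (i + 1) * acceptTotal μ x)) ≤ 1 := min_le_left _ _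
    rw [cost_scan_succ]
    refine (add_le_add (cost_levelCount_le hO hx n (i + 1) 0)
      (mul_le_mul' ih (ev_levelCount_zero_le_min hO hx n (i + 1)))).trans ?_
    rw [← ENNReal.ofReal_mul (by positivity), ← ENNReal.ofReal_add (by positivity) (by positivity)]
    apply ENNReal.ofReal_le_ofReal
    rw [scanRate, excess]
    set q := min 1 (2 / (1 + rate (i + 1) * acceptTotal μ x))
    have hE : (0 : ℝ) ≤ excess μ x i := Nat.cast_nonneg _
    have hEq : (excess μ x i : ℝ) * q ≤ excess μ x i := mul_le_of_le_one_right hE hm1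
    have hone : 1 ≤ rate (i + 1) / mass μ x + if rate (i + 1) < mass μ x then (1 : ℝ) else 0 := by
      split_ifs with h
      · have : 0 ≤ rate (i + 1) / mass μ x := by positivity
        linarith
      · rw [add_zero, one_le_div hx]
        exact not_lt.1 h
    have e1 : 4 * ((rate (i + 1) + q * scanRate (acceptTotal μ x) i) / mass μ x) =
        4 * (rate (i + 1) / mass μ x) + 4 * (scanRate (acceptTotal μ x) i / mass μ x) * q := by
      ring
    rw [e1]
    push_cast
    linarith

/-- The scan rarely stops at a level whose density is too small, wherever it starts. -/
theorem ev_scan_sparse_le (hO : IsCondOracle μ O) (hx : 0 < mass μ x) {P : ℕ → Prop}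
    [DecidablePred P] (hP0 : ¬ P 0) {t : ℝ} (ht : 0 ≤ t) (hP : ∀ r, P r → rate r ≤ t) (n i : ℕ) :
    (scan x n i).ev O (onSome fun j : ℕ => if P j then 1 else 0) ≤
      ENNReal.ofReal (acceptTotal μ x * (2 * t)) := by
  have hR := acceptTotal_nonneg μ x
  have key : (scan x n i).ev O (onSome fun j : ℕ => if P j then 1 else 0) ≤
      ENNReal.ofReal (acceptTotal μ x *
        ∑ r ∈ Finset.range (i + 1), if P r then rate r else 0) := by
    have hs : ∀ i, 0 ≤ ∑ r ∈ Finset.range (i + 1), if P r then rate r else 0 := fun i =>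
      Finset.sum_nonneg fun r _ => by split_ifs; exacts [(rate_pos r).le, le_rfl]
    induction i with
    | zero => simp [scan, ev, hP0]
    | succ i ih =>
      rw [ev_scan_succ, Finset.sum_range_succ, mul_add, ENNReal.ofReal_add
        (mul_nonneg hR (hs i)) (mul_nonneg hR (by split_ifs; exacts [(rate_pos _).le, le_rfl]))]
      refine add_le_add ?_ ?_
      · exact (mul_le_of_le_one_right zero_le (ev_indicator_le_one _)).trans ih
      · split_ifs
        · rw [one_mul, mul_comm (acceptTotal μ x)]
          exact ev_levelCount_pos_le hO hx n (i + 1)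
        · simp
  refine key.trans (ENNReal.ofReal_le_ofReal ?_)
  gcongr
  exact sum_filter_rate_le ht hP (i + 1)

end CondAlg

/-! ### The estimator -/

/-- The estimate of the mass from a total waiting time `T` and a total count `S` at the density
`r`, each over `k` repetitions. -/
def estimate (k : ℕ) (r : ℝ) (T S : ℕ) : ℝ := k ^ 2 / (T * (k + S / r))

theorem estimate_mem_Icc {k T S : ℕ} {r m R δ : ℝ} (hk : 0 < (k : ℝ)) (hr : 0 < r) (hm : 0 < m)
    (hR : 0 ≤ R) (hδ : 0 < δ) (hδ1 : δ ≤ 1 / 40)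
    (hT : |(T : ℝ) - k * (1 / (m * (1 + R)))| ≤ δ * (k * (1 / (m * (1 + R)))))
    (hS : |(S : ℝ) - k * (r * R)| ≤ δ * (k * (r * (1 + R)))) :
    estimate k r T S ∈ Set.Icc ((1 - 4 * δ) * m) ((1 + 4 * δ) * m) := by
  have hT' : (T : ℝ) = (T * (m * (1 + R)) / k) * (k * (1 / (m * (1 + R)))) := by
    field_simp
  have hS' : (k + S / r : ℝ) = ((k + S / r) / (k * (1 + R))) * (k * (1 + R)) := by
    field_simp
  set τ : ℝ := T * (m * (1 + R)) / k with hτ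
  set σ : ℝ := (k + S / r) / (k * (1 + R)) with hσ
  have hτ1 : |τ - 1| ≤ δ := by
    have hp : 0 < (k : ℝ) * (1 / (m * (1 + R))) := by positivity
    rw [hT', ← sub_one_mul, abs_mul, abs_of_pos hp] at hT
    exact le_of_mul_le_mul_right hT hp
  have hσ1 : |σ - 1| ≤ δ := by
    have hp : 0 < (k : ℝ) * (r * (1 + R)) := by positivity
    have e : (S : ℝ) - k * (r * R) = (σ - 1) * (k * (r * (1 + R))) := by
      rw [hσ]
      field_simp
      ring
    rw [e, abs_mul, abs_of_pos hp] at hS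
    exact le_of_mul_le_mul_right hS hp
  rw [abs_le] at hτ1 hσ1
  have hτ0 : 0 < τ := by linarith
  have hσ0 : 0 < σ := by linarith
  have he : estimate k r T S = m / (τ * σ) := by
    rw [estimate, hS', hT']
    field_simp
  have h1 : τ * σ ≤ (1 + δ) * (1 + δ) := by gcongr <;> linarith
  have h2 : (1 - δ) * (1 - δ) ≤ τ * σ := by
    refine mul_le_mul ?_ ?_ ?_ ?_ <;> linarith
  have h0 : 0 < τ * σ := by positivity
  rw [he]
  constructor
  · rw [le_div_iff₀ h0]
    have : (1 - 4 * δ) * (τ * σ) ≤ (1 - 4 * δ) * ((1 + δ) * (1 + δ)) :=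
      mul_le_mul_of_nonneg_left h1 (by linarith)
    have : (1 - 4 * δ) * (τ * σ) ≤ 1 := by nlinarith [pow_pos hδ 3]
    nlinarith
  · rw [div_le_iff₀ h0]
    have : (1 + 4 * δ) * ((1 - δ) * (1 - δ)) ≤ (1 + 4 * δ) * (τ * σ) :=
      mul_le_mul_of_nonneg_left h2 (by linarith)
    have : 1 ≤ (1 + 4 * δ) * (τ * σ) := by nlinarith [pow_pos hδ 3]
    nlinarith

/-- The number of repetitions. With relative deviations of `ε / 4`, Chebyshev's inequality bounds the
failure probabilities by `16 v / (ε ^ 2 k)`, where `v` is the relative variance of one repetition: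
`1` for the waiting times and at most `73` for the counts. -/
def reps (ε : ℝ) : ℕ := ⌈20000 / ε ^ 2⌉₊

/-- The number of steps of the binary search, such that its range reaches the density `1 / N`. -/
def searchDepth (N : ℕ) : ℕ := Nat.clog 2 (Nat.clog 2 N + 1)

theorem le_reps (ε : ℝ) : 20000 / ε ^ 2 ≤ reps ε := Nat.le_ceil _

theorem reps_pos {ε : ℝ} (hε : 0 < ε) : 0 < (reps ε : ℝ) :=
  lt_of_lt_of_le (by positivity) (le_reps ε)

theorem le_two_pow_searchDepth (N : ℕ) : N ≤ 2 ^ (2 ^ searchDepth N - 1) := by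
  refine (Nat.le_pow_clog one_lt_two N).trans (Nat.pow_le_pow_right two_pos ?_)
  have := Nat.le_pow_clog one_lt_two (Nat.clog 2 N + 1)
  rw [searchDepth]
  omega

namespace CondAlg

variable {Ω : Type u} [Fintype Ω] {μ : PMF Ω} {O : Set Ω → PMF Ω} {x : Ω}

/-- The estimator without a bound for the total number of samples. The waiting times estimate the
success probability `μ(x) (1 + R)` of a comparison over the whole domain, where `R` is the total
relative acceptance mass of the other elements. The search and the scan find a density at which a
random set has constant relative acceptance mass, and the counts at this density estimate `R`. Every
loop gives up after `n` iterations. -/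
def estimator (k d n : ℕ) (x : Ω) : CondAlg Ω (Option ℝ) :=
  (iter (waitLoop x n) k 0).obind fun T =>
    (search x d 0).bind fun i =>
      (scan x n i).obind fun j =>
        (iter (levelCount x n j) k 0).obind fun S => output (some (estimate k (rate j) T S))

theorem NoneAfter.estimator (k d n : ℕ) : (estimator k d n x).NoneAfter n := by
  refine (NoneAfter.iter (fun g => NoneAfter.waitLoop n g) k 0).obind fun T => ?_
  refine NoneAfter.bind fun i => ?_
  refine (NoneAfter.scan n i).obind fun j => ?_
  exact (NoneAfter.iter (fun g => NoneAfter.levelCount n j g) k 0).obind fun S h => by simp at h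

theorem Safe.estimator {k : ℕ} (hk : k ≠ 0) (d n : ℕ) :
    (estimator k d n x).Safe μ fun o => o ≠ none → x ∈ μ.support := by
  refine (Safe.iter (fun h => absurd rfl h) (fun g => Safe.waitLoop n g) hk).bind fun o ho => ?_
  cases o with
  | none => exact fun h => absurd rfl h
  | some T =>
    have hx := ho (by simp)
    refine (Safe.search hx d 0).bind fun i _ => ?_
    refine (Safe.scan hx n i).bind fun o _ => ?_
    cases o with
    | none => exact fun h => absurd rfl h
    | some j =>
      refine (Safe.iter (P := fun _ => True) trivial (fun g => Safe.levelCount hx n j g) hk).bind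
        fun o _ => ?_
      cases o with
      | none => exact fun h => absurd rfl h
      | some S => exact fun _ => hx

theorem cost_obind_output {R S : Type} (a : CondAlg Ω (Option R)) (h : R → Option S) :
    (a.obind fun r => output (h r)).cost O = a.cost O := by
  rw [cost_obind]
  have : a.ev O (onSome fun r => (output (h r) : CondAlg Ω (Option S)).cost O) = 0 :=
    le_antisymm (ev_onSome_const_le O 0 a) zero_le
  rw [this, add_zero]

theorem cost_estimator_le (hO : IsCondOracle μ O) (hx : 0 < mass μ x) {k d n : ℕ} (hk : 1 ≤ k)
    (hd : Fintype.card Ω ≤ 2 ^ (2 ^ d - 1)) :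
    (estimator k d n x).cost O ≤ ENNReal.ofReal (2 * d + 704 * (k / hitTotal μ x)) := by
  have hR := acceptTotal_nonneg μ x
  have hp := hitTotal_pos hx
  have hp1 := hitTotal_le_one hx
  have hk0 : (0 : ℝ) ≤ k := Nat.cast_nonneg _
  set U : ℕ → ℝ := scanRate (acceptTotal μ x) with hU
  have hU0 : ∀ i, 0 ≤ U i := scanRate_nonneg hR
  have hcount : ∀ j, (iter (levelCount x n j) k 0).cost O ≤
      ENNReal.ofReal (2 * k) + ENNReal.ofReal (2 * k / mass μ x) * ENNReal.ofReal (rate j) := by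
    intro j
    have hr := rate_pos j
    refine (cost_iter_le (fun g => cost_levelCount_le hO hx n j g) k 0).trans (le_of_eq ?_)
    rw [← ENNReal.ofReal_natCast, ← ENNReal.ofReal_mul hk0, ← ENNReal.ofReal_mul (by positivity),
      ← ENNReal.ofReal_add (by positivity) (by positivity)]
    congr 1
    ring
  have hscan : ∀ T i, ((scan x n i).obind fun j => (iter (levelCount x n j) k 0).obind fun S =>
      output (some (estimate k (rate j) T S))).cost O ≤
      ENNReal.ofReal (2 * k) + ENNReal.ofReal ((4 + 2 * k) / mass μ x) * ENNReal.ofReal (U i) +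
        ENNReal.ofReal 2 * (excess μ x i : ℝ≥0∞) := by
    intro T i
    rw [cost_obind]
    have h1 : (scan x n i).ev O (onSome fun j => ((iter (levelCount x n j) k 0).obind fun S =>
        output (some (estimate k (rate j) T S))).cost O) ≤
        ENNReal.ofReal (2 * k) + ENNReal.ofReal (2 * k / mass μ x) * ENNReal.ofReal (U i) := by
      refine (ev_onSome_mono O (g := fun j => ENNReal.ofReal (2 * k) +
        ENNReal.ofReal (2 * k / mass μ x) * ENNReal.ofReal (rate j)) (fun j => ?_) _).trans ?_
      · rw [cost_obind_output]
        exact hcount j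
      · rw [ev_onSome_add, ev_onSome_const_mul]
        exact add_le_add (ev_onSome_const_le O _ _) (mul_le_mul' le_rfl (ev_scan_rate_le hO hx n i))
    refine (add_le_add (cost_scan_le hO hx n i) h1).trans (le_of_eq ?_)
    have hUi := hU0 i
    rw [← ENNReal.ofReal_natCast, ← ENNReal.ofReal_mul (by positivity),
      ← ENNReal.ofReal_mul (by positivity), ← ENNReal.ofReal_mul (by positivity),
      ← ENNReal.ofReal_add (by positivity) (by positivity),
      ← ENNReal.ofReal_add (by positivity) (by positivity),
      ← ENNReal.ofReal_add (by positivity) (by positivity),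
      ← ENNReal.ofReal_add (by positivity) (by positivity)]
    congr 1
    ring
  have hEU : (search x d 0).ev O (fun i => ENNReal.ofReal (U i)) ≤
      ENNReal.ofReal (114 / (1 + acceptTotal μ x)) := by
    calc _ ≤ (search x d 0).ev O (fun i => ENNReal.ofReal (48 / (1 + acceptTotal μ x)) +
          ENNReal.ofReal 2 * ENNReal.ofReal (rate i)) := by
          refine ev_mono O (fun i => ?_) _
          have hr := rate_pos i
          rw [← ENNReal.ofReal_mul (by norm_num),
            ← ENNReal.ofReal_add (by positivity) (by positivity)]
          exact ENNReal.ofReal_le_ofReal (scanRate_le hR i)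
      _ ≤ ENNReal.ofReal (48 / (1 + acceptTotal μ x)) +
          ENNReal.ofReal 2 * ENNReal.ofReal (33 / (1 + acceptTotal μ x)) := by
          rw [ev_add, ev_const, ev_const_mul]
          gcongr
          exact ev_search_rate_le hO hx hd
      _ = _ := by
          rw [← ENNReal.ofReal_mul (by norm_num),
            ← ENNReal.ofReal_add (by positivity) (by positivity)]
          congr 1
          ring
  have hsearch : ∀ T, ((search x d 0).bind fun i => (scan x n i).obind fun j =>
      (iter (levelCount x n j) k 0).obind fun S =>
        output (some (estimate k (rate j) T S))).cost O ≤
      ENNReal.ofReal (2 * d + (2 * k + (4 + 2 * k) / mass μ x * (114 / (1 + acceptTotal μ x)) +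
        2 * 8)) := by
    intro T
    rw [cost_bind]
    have h1 : (search x d 0).ev O (fun i => ((scan x n i).obind fun j =>
        (iter (levelCount x n j) k 0).obind fun S =>
          output (some (estimate k (rate j) T S))).cost O) ≤
        ENNReal.ofReal (2 * k + (4 + 2 * k) / mass μ x * (114 / (1 + acceptTotal μ x)) +
          2 * 8) := by
      refine (ev_mono O (hscan T) _).trans ?_
      rw [ev_add, ev_add, ev_const, ev_const_mul, ev_const_mul,
        ENNReal.ofReal_add (by positivity) (by positivity),
        ENNReal.ofReal_add (by positivity) (by positivity),
        ENNReal.ofReal_mul (p := (4 + 2 * k) / mass μ x) (by positivity),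
        ENNReal.ofReal_mul (p := 2) (q := 8) (by positivity)]
      gcongr
      exact ev_search_excess_le hO hx d
    refine (add_le_add (cost_search_le d 0) h1).trans (le_of_eq ?_)
    rw [ENNReal.ofReal_add (p := 2 * d) (by positivity) (by positivity),
      ENNReal.ofReal_mul (p := 2) (q := d) (by norm_num), ENNReal.ofReal_natCast,
      ENNReal.ofReal_ofNat]
  rw [estimator, cost_obind]
  refine (add_le_add (cost_iter_le (fun g => cost_waitLoop_le hO hx n g) k 0)
    ((ev_onSome_mono O hsearch _).trans (ev_onSome_const_le O _ _))).trans ?_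
  rw [← ENNReal.ofReal_natCast, ← ENNReal.ofReal_mul hk0,
    ← ENNReal.ofReal_add (by positivity) (by positivity)]
  apply ENNReal.ofReal_le_ofReal
  have hk1 : (1 : ℝ) ≤ k := by exact_mod_cast hk
  have e1 : (4 + 2 * k) / mass μ x * (114 / (1 + acceptTotal μ x)) =
      (4 + 2 * k) * 114 / hitTotal μ x := by
    rw [hitTotal]
    field_simp
  have e2 : (k : ℝ) ≤ k / hitTotal μ x := (le_div_iff₀ hp).2 (mul_le_of_le_one_right hk0 hp1)
  have e3 : (4 + 2 * k) * 114 / hitTotal μ x ≤ 684 * (k / hitTotal μ x) := by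
    rw [← mul_div_assoc]
    exact div_le_div_of_nonneg_right (by linarith) hp.le
  rw [e1]
  have e4 : k * (2 / hitTotal μ x) = 2 * (k / hitTotal μ x) := by ring
  linarith

open Classical in
/-- The estimator returns a wrong value with probability at most `1 / 6`. -/
theorem ev_estimator_bad_le (hO : IsCondOracle μ O) (hx : 0 < mass μ x) {ε : ℝ} (hε : 0 < ε)
    (hε1 : ε < 1 / 10) (d n : ℕ) :
    (estimator (reps ε) d n x).ev O (onSome fun v =>
      if v ∈ Set.Icc ((1 - ε) * mass μ x) ((1 + ε) * mass μ x) then 0 else 1) ≤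
      ENNReal.ofReal (1 / 6) := by
  have hR := acceptTotal_nonneg μ x
  have hp := hitTotal_pos hx
  have hk := reps_pos hε
  set k := reps ε with hkdef
  set R := acceptTotal μ x with hRdef
  have hkδ : 1 / (k * (ε / 4) ^ 2) ≤ 1 / 1250 := by
    have h1 := le_reps ε
    rw [div_le_iff₀ (by positivity)] at h1
    apply one_div_le_one_div_of_le (by norm_num)
    nlinarith
  -- The three bad events: the total waiting time deviates, the scan stops at a too sparse level,
  -- the total count deviates.
  let bT : ℕ → Prop := fun T =>
    ε / 4 * (k * (1 / hitTotal μ x)) < |(T : ℝ) - k * (1 / hitTotal μ x)|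
  let bj : ℕ → Prop := fun j => rate j * (24 * (1 + R)) < 1
  let bS : ℕ → ℕ → Prop := fun j S =>
    ε / 4 * (k * (rate j * (1 + R))) < |(S : ℝ) - k * (rate j * R)|
  have hT : (iter (waitLoop x n) k 0).ev O (onSome fun T : ℕ => if bT T then 1 else 0) ≤
      ENNReal.ofReal (1 / 1250) := by
    have h := ev_iter_sq_le (by positivity) (fun g b => ev_waitLoop_sq_le hO hx n g b) k 0
      (-(k * (1 / hitTotal μ x)))
    refine (ev_deviation_le (δ := ε / 4 * (k * (1 / hitTotal μ x))) (by positivity) h).trans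
      (ENNReal.ofReal_le_ofReal (le_trans (le_of_eq ?_) hkδ))
    push_cast
    field_simp
    ring
  have hj : ∀ i, (scan x n i).ev O (onSome fun j : ℕ => if bj j then 1 else 0) ≤
      ENNReal.ofReal (1 / 12) := by
    intro i
    refine (ev_scan_sparse_le hO hx (P := bj) (t := 1 / (24 * (1 + R))) ?_ (by positivity)
      (fun r hr => ?_) n i).trans (ENNReal.ofReal_le_ofReal ?_)
    · simp only [bj, rate_zero]
      linarith
    · rw [le_div_iff₀ (by positivity)]
      exact le_of_lt hr
    · rw [← hRdef, ← mul_div_assoc, mul_one, ← mul_div_assoc,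
        div_le_div_iff₀ (by positivity) (by norm_num)]
      linarith
  have hS : ∀ j, ¬ bj j → (iter (levelCount x n j) k 0).ev O
      (onSome fun S : ℕ => if bS j S then 1 else 0) ≤ ENNReal.ofReal (73 / 1250) := by
    intro j hbj
    have hr := rate_pos j
    have h := ev_iter_sq_le (by positivity) (fun g b => ev_levelCount_sq_le hO hx n j g b) k 0
      (-(k * (rate j * R)))
    refine (ev_deviation_le (δ := ε / 4 * (k * (rate j * (1 + R)))) (by positivity) h).trans
      (ENNReal.ofReal_le_ofReal ?_)
    have hbj' : 1 ≤ rate j * (24 * (1 + R)) := not_lt.1 hbj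
    have e1 : (rate j * R) ^ 2 + 3 * (rate j * R) ≤ 73 * (rate j * (1 + R)) ^ 2 := by
      have h1 : (rate j * R) ^ 2 ≤ (rate j * (1 + R)) ^ 2 := by
        gcongr
        linarith
      have h2 : 3 * (rate j * R) ≤ 72 * (rate j * (1 + R)) ^ 2 := by
        calc 3 * (rate j * R) ≤ 3 * (rate j * (1 + R)) * 1 := by nlinarith
          _ ≤ 3 * (rate j * (1 + R)) * (rate j * (24 * (1 + R))) := by gcongr
          _ = _ := by ring
      linarith
    calc _ = k * ((rate j * R) ^ 2 + 3 * (rate j * R)) /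
          (ε / 4 * (k * (rate j * (1 + R)))) ^ 2 := by
          congr 1
          push_cast
          ring
      _ ≤ k * (73 * (rate j * (1 + R)) ^ 2) / (ε / 4 * (k * (rate j * (1 + R)))) ^ 2 := by gcongr
      _ = 73 * (1 / (k * (ε / 4) ^ 2)) := by
          field_simp
      _ ≤ 73 / 1250 := by linarith
  have hgood : ∀ T j S, ¬ bT T → ¬ bS j S →
      estimate k (rate j) T S ∈ Set.Icc ((1 - ε) * mass μ x) ((1 + ε) * mass μ x) := by
    intro T j S h1 h2
    have := estimate_mem_Icc hk (rate_pos j) hx hR (δ := ε / 4) (by positivity) (by linarith)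
      (not_lt.1 h1) (not_lt.1 h2)
    rwa [mul_div_cancel₀ ε (by norm_num : (4 : ℝ) ≠ 0)] at this
  have hfinish : ∀ T j, ((iter (levelCount x n j) k 0).obind fun S =>
      (output (some (estimate k (rate j) T S)) : CondAlg Ω (Option ℝ))).ev O (onSome fun v =>
        if v ∈ Set.Icc ((1 - ε) * mass μ x) ((1 + ε) * mass μ x) then 0 else 1) ≤
      (if bT T then 1 else 0) + (ENNReal.ofReal (73 / 1250) + if bj j then 1 else 0) := by
    intro T j
    rw [ev_obind]
    by_cases h1 : bT T
    · rw [if_pos h1]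
      refine le_trans ?_ le_self_add
      refine (ev_onSome_mono O (g := fun _ => 1) (fun S => ?_) _).trans (ev_onSome_const_le O 1 _)
      simp only [ev, onSome_some]
      split_ifs <;> simp
    · by_cases h2 : bj j
      · rw [if_pos h2]
        refine le_trans ?_ (le_add_self.trans le_add_self)
        refine (ev_onSome_mono O (g := fun _ => 1) (fun S => ?_) _).trans (ev_onSome_const_le O 1 _)
        simp only [ev, onSome_some]
        split_ifs <;> simp
      · rw [if_neg h1, if_neg h2, zero_add, add_zero]
        refine le_trans (ev_onSome_mono O (fun S => ?_) _) (hS j h2)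
        simp only [ev, onSome_some]
        by_cases h3 : bS j S
        · rw [if_pos h3]
          split_ifs <;> simp
        · rw [if_pos (hgood T j S h1 h3)]
          exact zero_le
  rw [estimator, ev_obind]
  calc _ ≤ (iter (waitLoop x n) k 0).ev O (onSome fun T : ℕ => (if bT T then 1 else 0) +
        (ENNReal.ofReal (73 / 1250) + ENNReal.ofReal (1 / 12))) := by
        refine ev_onSome_mono O (fun T => ?_) _
        rw [ev_bind]
        refine (ev_mono O (fun i => ?_) _).trans (ev_const O _ _).le
        rw [ev_obind]
        refine (ev_onSome_mono O (hfinish T) _).trans ?_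
        rw [ev_onSome_add, ev_onSome_add]
        exact add_le_add (ev_onSome_const_le O _ _)
          (add_le_add (ev_onSome_const_le O _ _) (hj i))
    _ ≤ ENNReal.ofReal (1 / 1250) + (ENNReal.ofReal (73 / 1250) + ENNReal.ofReal (1 / 12)) := by
        rw [ev_onSome_add]
        exact add_le_add hT (ev_onSome_const_le O _ _)
    _ ≤ _ := by
        rw [← ENNReal.ofReal_add (by norm_num) (by norm_num),
          ← ENNReal.ofReal_add (by norm_num) (by norm_num)]
        exact ENNReal.ofReal_le_ofReal (by norm_num)

end CondAlg

/-! ### The weight and the success probability of a comparison -/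

section Weight

variable {Ω : Type u} [Fintype Ω] {μ : PMF Ω} {x : Ω}

open Classical in
theorem hitTotal_eq : hitTotal μ x =
    mass μ x + ∑ y ∈ Finset.univ.erase x, mass μ y * (mass μ x / (mass μ x + mass μ y)) := by
  rw [hitTotal, mul_add, mul_one, acceptTotal, acceptSum, Finset.mul_sum]
  congr 1
  refine Finset.sum_congr rfl fun y _ => ?_
  rw [accept]
  ring

theorem hitTotal_eq_zero (hx : mass μ x = 0) : hitTotal μ x = 0 := by
  rw [hitTotal, hx, zero_mul]

open Classical in
/-- Elements `y` with `μ(x) + μ(y) ≤ b μ(x)` are accepted with a probability of at least `1 / b`, so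
their mass is at most `b` times their acceptance mass. -/
theorem mass_add_sum_le {s : Finset Ω} (hx : 0 < mass μ x) (hxs : x ∉ s) {b : ℝ}
    (hs : ∀ y ∈ s, mass μ x + mass μ y ≤ b * mass μ x) (hb : 1 ≤ b) :
    mass μ x + ∑ y ∈ s, mass μ y ≤ b * hitTotal μ x := by
  have h1 : ∑ y ∈ s, mass μ y ≤
      b * ∑ y ∈ s, mass μ y * (mass μ x / (mass μ x + mass μ y)) := by
    rw [Finset.mul_sum]
    refine Finset.sum_le_sum fun y hy => ?_
    have hy0 := mass_nonneg μ y
    have hpos : 0 < mass μ x + mass μ y := by linarith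
    have : 1 ≤ b * (mass μ x / (mass μ x + mass μ y)) := by
      rw [← mul_div_assoc, le_div_iff₀ hpos, one_mul]
      exact hs y hy
    nlinarith
  have h2 : ∑ y ∈ s, mass μ y * (mass μ x / (mass μ x + mass μ y)) ≤
      ∑ y ∈ Finset.univ.erase x, mass μ y * (mass μ x / (mass μ x + mass μ y)) := by
    refine Finset.sum_le_sum_of_subset_of_nonneg (fun y hy => ?_) fun y _ _ => ?_
    · exact Finset.mem_erase.2 ⟨fun h => hxs (h ▸ hy), Finset.mem_univ y⟩
    · have := mass_nonneg μ y
      positivity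
  rw [hitTotal_eq]
  nlinarith

theorem cdfAt_le (hx : 0 < mass μ x) : cdfAt μ (mass μ x) ≤ 2 * hitTotal μ x := by
  classical
  have h : cdfAt μ (mass μ x) =
      mass μ x + ∑ y ∈ (Finset.univ.filter fun y => mass μ y ≤ mass μ x).erase x, mass μ y := by
    rw [cdfAt]
    convert (Finset.add_sum_erase (Finset.univ.filter fun y => mass μ y ≤ mass μ x) (mass μ)
      (a := x) (by simp)).symm
  rw [h]
  refine mass_add_sum_le hx (by simp) (fun y hy => ?_) one_le_two
  have := (Finset.mem_filter.1 (Finset.mem_of_mem_erase hy)).2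
  linarith

theorem cdfAt_eq_zero (hx : mass μ x = 0) : cdfAt μ (mass μ x) = 0 := by
  classical
  refine Finset.sum_eq_zero fun y hy => ?_
  have := (Finset.mem_filter.1 hy).2
  rw [hx] at this
  exact le_antisymm this (mass_nonneg μ y)

theorem mass_le_cdfAt : mass μ x ≤ cdfAt μ (mass μ x) := by
  classical
  exact Finset.single_le_sum (f := mass μ) (fun y _ => mass_nonneg μ y) (by simp)

theorem binLower_nonneg (ℓ : ℕ) {p : ℝ} (h0 : 0 ≤ p) (h1 : p ≤ 1) (t : ℝ) : 0 ≤ binLower ℓ p t :=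
  Finset.sum_nonneg fun k _ => by
    have : 0 ≤ 1 - p := by linarith
    positivity

theorem binLower_le_one (ℓ : ℕ) {p : ℝ} (h0 : 0 ≤ p) (h1 : p ≤ 1) (t : ℝ) :
    binLower ℓ p t ≤ 1 := by
  classical
  have h := add_pow p (1 - p) ℓ
  rw [add_sub_cancel, one_pow] at h
  rw [h, binLower]
  refine (Finset.sum_le_sum_of_subset_of_nonneg (Finset.filter_subset _ _) fun k _ _ => ?_).trans
    (le_of_eq (Finset.sum_congr rfl fun k _ => by ring))
  have : 0 ≤ 1 - p := by linarith
  positivity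

theorem targetFn_mem_Icc {κ : ℝ} (hκ : κ < 1 / 44) (η : ℝ) (y : Ω) :
    targetFn κ η μ x y ∈ Set.Icc (0 : ℝ) 1 := by
  unfold targetFn
  split_ifs
  · simp
  · have h0 := mass_nonneg μ x
    have h1 := mass_nonneg μ y
    have hp0 : 0 ≤ mass μ y / (mass μ x + mass μ y) := by positivity
    have hp1 : mass μ y / (mass μ x + mass μ y) ≤ 1 := div_le_one_of_le₀ (by linarith) (by linarith)
    have hd : 0 < (6 / 11 - κ) - (1 / 2 + κ) := by linarith
    refine ⟨div_nonneg (intervalIntegral.integral_nonneg (by linarith) fun t _ =>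
      binLower_nonneg _ hp0 hp1 t) hd.le, ?_⟩
    rw [div_le_one hd]
    refine (le_abs_self _).trans ?_
    have := intervalIntegral.norm_integral_le_of_norm_le_const (a := 1 / 2 + κ) (b := 6 / 11 - κ)
      (f := fun t => binLower ⌈Real.log (1 / η) / (2 * κ ^ 2)⌉₊
        (mass μ y / (mass μ x + mass μ y)) t) (C := 1) fun t _ => by
        rw [Real.norm_eq_abs, abs_of_nonneg (binLower_nonneg _ hp0 hp1 t)]
        exact binLower_le_one _ hp0 hp1 t
    rwa [one_mul, abs_of_pos hd, Real.norm_eq_abs] at this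

theorem weight_nonneg {κ : ℝ} (hκ : κ < 1 / 44) (η : ℝ) : 0 ≤ weight κ η μ x :=
  add_nonneg (mass_nonneg μ x) (add_nonneg (Finset.sum_nonneg fun y _ => mass_nonneg μ y)
    (Finset.sum_nonneg fun y _ => mul_nonneg (mass_nonneg μ y) (targetFn_mem_Icc hκ η y).1))

/-- Whatever the parameters of the target test are, the weight is at most of the order of the
success probability of a comparison, since it counts only elements of mass less than
`1.2 μ(x)`. -/
theorem weight_le {κ : ℝ} (hκ : κ < 1 / 44) (η : ℝ) :
    weight κ η μ x ≤ 11 / 5 * hitTotal μ x := by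
  classical
  rcases (mass_nonneg μ x).eq_or_lt with hx | hx
  · rw [hitTotal_eq_zero hx.symm, weight, scaleMass, ← hx, mul_zero]
    apply le_of_eq
    have h1 : ∑ y ∈ lightSet μ x, mass μ y = 0 := Finset.sum_eq_zero fun y hy => by
      have := (Finset.mem_filter.1 hy).2.2
      exact le_antisymm (hx ▸ this) (mass_nonneg μ y)
    have h2 : mediumSet μ x = ∅ := Finset.eq_empty_of_forall_notMem fun y hy => by
      have := (Finset.mem_filter.1 hy).2
      rw [← hx] at this
      linarith [this.1, this.2]
    rw [h1, h2]
    simp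
  · have hdisj : Disjoint (lightSet μ x) (mediumSet μ x) := by
      rw [Finset.disjoint_left]
      intro y h1 h2
      exact absurd (Finset.mem_filter.1 h2).2.1 (not_lt.2 (Finset.mem_filter.1 h1).2.2)
    have h := mass_add_sum_le (s := lightSet μ x ∪ mediumSet μ x) (b := 11 / 5) hx ?_
      (fun y hy => ?_) (by norm_num)
    · rw [Finset.sum_union hdisj] at h
      refine le_trans ?_ h
      rw [weight, scaleMass]
      gcongr with y hy
      exact mul_le_of_le_one_right (mass_nonneg μ y) (targetFn_mem_Icc hκ η y).2
    · simp [lightSet, mediumSet]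
    · rcases Finset.mem_union.1 hy with hy | hy
      · have := (Finset.mem_filter.1 hy).2.2
        linarith
      · have := (Finset.mem_filter.1 hy).2.2
        linarith

open Classical in
/-- The average of `1 / (c + CDF)` over a random element is at most logarithmic: after sorting the
elements by mass, it is a lower Riemann sum for `∫ dt / (c + t)`. -/
theorem sum_div_add_partial_le (μ : PMF Ω) {c : ℝ} (hc : 0 < c) (s : Finset Ω) :
    ∑ x ∈ s, mass μ x / (c + ∑ y ∈ s with mass μ y ≤ mass μ x, mass μ y) ≤
      Real.log (c + ∑ y ∈ s, mass μ y) - Real.log c := by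
  induction s using Finset.induction_on_max_value (mass μ) with
  | empty => simp
  | insert a s ha hmax ih =>
    have hs : 0 ≤ ∑ y ∈ s, mass μ y := Finset.sum_nonneg fun y _ => mass_nonneg μ y
    have ha0 := mass_nonneg μ a
    rw [Finset.sum_insert ha, Finset.sum_insert ha]
    have htop : (insert a s).filter (fun y => mass μ y ≤ mass μ a) = insert a s := by
      refine Finset.filter_true_of_mem fun y hy => ?_
      rcases Finset.mem_insert.1 hy with rfl | hy
      · exact le_rfl
      · exact hmax y hy
    rw [htop, Finset.sum_insert ha]
    have h1 : ∑ x ∈ s, mass μ x / (c + ∑ y ∈ insert a s with mass μ y ≤ mass μ x, mass μ y) ≤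
        ∑ x ∈ s, mass μ x / (c + ∑ y ∈ s with mass μ y ≤ mass μ x, mass μ y) := by
      refine Finset.sum_le_sum fun x _ => ?_
      have h0 : 0 ≤ ∑ y ∈ s with mass μ y ≤ mass μ x, mass μ y :=
        Finset.sum_nonneg fun y _ => mass_nonneg μ y
      refine div_le_div_of_nonneg_left (mass_nonneg μ x) (by linarith) ?_
      refine add_le_add le_rfl
        (Finset.sum_le_sum_of_subset_of_nonneg ?_ fun y _ _ => mass_nonneg μ y)
      exact Finset.filter_subset_filter _ (Finset.subset_insert a s)
    set S := ∑ y ∈ s, mass μ y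
    have h2 : mass μ a / (c + (mass μ a + S)) ≤
        Real.log (c + (mass μ a + S)) - Real.log (c + S) := by
      have hpos : 0 < c + (mass μ a + S) := by linarith
      have := Real.log_le_sub_one_of_pos (x := (c + S) / (c + (mass μ a + S)))
        (by have : 0 < c + S := by linarith
            positivity)
      rw [Real.log_div (by linarith) hpos.ne'] at this
      have e : (c + S) / (c + (mass μ a + S)) - 1 = -(mass μ a / (c + (mass μ a + S))) := by
        field_simp
        ring
      linarith
    linarith

theorem sum_div_add_cdfAt_le (μ : PMF Ω) {c : ℝ} (hc : 0 < c) (hc1 : c < 1 / 16) :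
    ∑ x, mass μ x / (c + cdfAt μ (mass μ x)) ≤ 2 * Real.log (1 / c) := by
  classical
  have h := sum_div_add_partial_le μ hc Finset.univ
  rw [sum_mass] at h
  have h1 : Real.log (c + 1) ≤ -Real.log c := by
    rw [← Real.log_inv]
    refine Real.log_le_log (by linarith) ?_
    rw [le_inv_comm₀ (by linarith) hc, ← one_div, le_div_iff₀ (by linarith)]
    nlinarith
  rw [one_div, Real.log_inv]
  refine le_trans (le_of_eq ?_) (h.trans (by linarith))
  refine Finset.sum_congr rfl fun x _ => ?_
  rw [cdfAt]

end Weight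

/-! ### The algorithm with a sample budget -/

/-- The number of samples after which the algorithm gives up: six times the bound of
`cost_estimator_le` for a success probability of `c / 2`. -/
def budget (ε c : ℝ) (N : ℕ) : ℕ := 12 * searchDepth N + ⌈8448 * reps ε / c⌉₊

namespace CondAlg

variable {Ω : Type u} [Fintype Ω] {μ : PMF Ω} {O : Set Ω → PMF Ω} {x : Ω}

/-- The estimator, cut off when it exceeds its sample budget. -/
def massEstimator (ε c : ℝ) (x : Ω) : CondAlg Ω (Option ℝ) :=
  (estimator (reps ε) (searchDepth (Fintype.card Ω)) (budget ε c (Fintype.card Ω)) x).limit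
    (budget ε c (Fintype.card Ω))

theorem Safe.massEstimator {ε : ℝ} (hε : 0 < ε) (c : ℝ) :
    (massEstimator ε c x).Safe μ fun o => o ≠ none → x ∈ μ.support :=
  (Safe.estimator (by exact_mod_cast (reps_pos hε).ne') _ _).limit (fun h => absurd rfl h) _

theorem le_ev_indicator {R : Type} {a : CondAlg Ω R} {s : Set R} {b : ℝ≥0∞} (hb : b ≤ 1 / 3)
    (h : a.ev O (sᶜ.indicator 1) ≤ b) : 2 / 3 ≤ a.ev O (s.indicator 1) := by
  have h1 : a.ev O (s.indicator 1) + a.ev O (sᶜ.indicator 1) = 1 := by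
    rw [← ev_add, ← ev_const O 1 a]
    congr 1
    funext r
    by_cases hr : r ∈ s <;> simp [hr]
  have h2 : (2 / 3 : ℝ≥0∞) + 1 / 3 = 1 := by
    rw [ENNReal.div_add_div_same, two_add_one_eq_three,
      ENNReal.div_self (by norm_num) (by norm_num)]
  have h3 : (2 / 3 : ℝ≥0∞) + 1 / 3 ≤ a.ev O (s.indicator 1) + 1 / 3 :=
    (h2.trans h1.symm).le.trans (add_le_add le_rfl (h.trans hb))
  exact (ENNReal.add_le_add_iff_right (by norm_num)).1 h3

open Classical in
theorem ev_massEstimator_bad_le (hO : IsCondOracle μ O) (hx : 0 < mass μ x) {ε : ℝ} (hε : 0 < ε)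
    (hε1 : ε < 1 / 10) (c : ℝ) :
    (massEstimator ε c x).ev O (onSome fun v =>
      if v ∈ Set.Icc ((1 - ε) * mass μ x) ((1 + ε) * mass μ x) then 0 else 1) ≤
      ENNReal.ofReal (1 / 6) :=
  (ev_limit_le O _ _ _).trans (ev_estimator_bad_le hO hx hε hε1 _ _)

theorem one_le_reps {ε : ℝ} (hε : 0 < ε) : 1 ≤ reps ε :=
  Nat.one_le_iff_ne_zero.2 (by exact_mod_cast (reps_pos hε).ne')

/-- If the comparison succeeds with probability at least `c / 2`, the budget suffices with
probability `5 / 6`. -/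
theorem ev_massEstimator_none_le (hO : IsCondOracle μ O) (hx : 0 < mass μ x) {ε c : ℝ} (hε : 0 < ε)
    (hc : 0 < c) (hp : c ≤ 2 * hitTotal μ x) :
    (massEstimator ε c x).ev O (Set.indicator {none} 1) ≤ ENNReal.ofReal (1 / 6) := by
  set D := searchDepth (Fintype.card Ω) with hD
  set F := budget ε c (Fintype.card Ω) with hF
  have hk := reps_pos hε
  have hF1 : 12 * (D : ℝ) + 8448 * reps ε / c ≤ F := by
    rw [hF, budget]
    push_cast
    gcongr
    exact Nat.le_ceil _
  have hF0 : 0 < (F : ℝ) := lt_of_lt_of_le (by positivity) hF1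
  have h := (mul_ev_limit_none_le O (NoneAfter.estimator (x := x) (reps ε) D F)).trans
    (cost_estimator_le hO hx (one_le_reps hε) (le_two_pow_searchDepth _))
  have h2 : 2 * (D : ℝ) + 704 * (reps ε / hitTotal μ x) ≤ F * (1 / 6) := by
    have : reps ε / hitTotal μ x ≤ 2 * (reps ε / c) := by
      rw [← mul_div_assoc, div_le_div_iff₀ (hitTotal_pos hx) hc]
      nlinarith
    have e : 8448 * reps ε / c = 8448 * (reps ε / c) := by ring
    linarith
  have h3 := h.trans (ENNReal.ofReal_le_ofReal h2)
  rw [ENNReal.ofReal_mul hF0.le, ENNReal.ofReal_natCast] at h3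
  exact (ENNReal.mul_le_mul_iff_right (by exact_mod_cast hF0.ne') (ENNReal.natCast_ne_top F)).1 h3

theorem solves_massEstimator (hO : IsCondOracle μ O) {ε c : ℝ} (hε : 0 < ε) (hε1 : ε < 1 / 10)
    (hc : 0 < c) :
    SolvesEstimationTask ε c μ x ((massEstimator ε c x).outputDist O) := by
  classical
  have hsixth : ENNReal.ofReal (1 / 6) ≤ 1 / 3 := by
    rw [ENNReal.ofReal_div_of_pos (by norm_num), ENNReal.ofReal_one, ENNReal.ofReal_ofNat]
    exact ENNReal.div_le_div_left (by norm_num) 1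
  have hthird : ENNReal.ofReal (1 / 6) + ENNReal.ofReal (1 / 6) ≤ 1 / 3 := by
    rw [← ENNReal.ofReal_add (by norm_num) (by norm_num),
      show (1 / 6 : ℝ) + 1 / 6 = 1 / 3 by norm_num,
      ENNReal.ofReal_div_of_pos (by norm_num), ENNReal.ofReal_one, ENNReal.ofReal_ofNat]
  refine ⟨fun h => ?_, fun h _ => ?_, fun h => ?_⟩
  all_goals rw [toOuterMeasure_outputDist]
  · have hx : x ∉ μ.support := fun hx =>
      absurd ((mass_pos_iff μ x).2 hx) (not_lt.2 (mass_le_cdfAt.trans h))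
    refine le_ev_indicator (b := 0) zero_le (le_of_eq ?_)
    refine (Safe.massEstimator hε c).ev_eq_zero hO fun o ho => ?_
    have : o = none := by
      by_contra h'
      exact hx (ho h')
    simp [this]
  · have hx : 0 < mass μ x := by
      refine (mass_nonneg μ x).lt_of_ne fun hx => ?_
      rw [cdfAt_eq_zero hx.symm] at h
      exact lt_irrefl 0 h
    refine le_ev_indicator hsixth ((ev_mono O (fun o => ?_) _).trans
      (ev_massEstimator_bad_le hO hx hε hε1 c))
    cases o with
    | none => simp
    | some v =>
      by_cases hv : v ∈ Set.Icc ((1 - ε) * mass μ x) ((1 + ε) * mass μ x)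
      · rw [Set.indicator_of_notMem]
        · exact zero_le
        · simpa using hv
      · rw [onSome_some, if_neg hv]
        exact Set.indicator_le_self' (fun _ _ => zero_le) _
  · have hx : 0 < mass μ x := by
      refine (mass_nonneg μ x).lt_of_ne fun hx => ?_
      rw [cdfAt_eq_zero hx.symm] at h
      linarith
    refine le_ev_indicator hthird ?_
    refine le_trans ?_ (add_le_add (ev_massEstimator_none_le hO hx hε hc (h.trans (cdfAt_le hx)))
      (ev_massEstimator_bad_le hO hx hε hε1 c))
    rw [← ev_add]
    refine ev_mono O (fun o => ?_) _
    cases o with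
    | none => simp
    | some v =>
      by_cases hv : v ∈ Set.Icc ((1 - ε) * mass μ x) ((1 + ε) * mass μ x)
      · rw [Set.indicator_of_notMem]
        · exact zero_le
        · simpa using hv
      · rw [onSome_some, if_neg hv]
        exact (Set.indicator_le_self' (fun _ _ => zero_le) _).trans le_add_self

end CondAlg

/-! ### The sample bounds -/

theorem logLog_nonneg (N : ℕ) : 0 ≤ logLog N := le_max_left _ _

theorem searchDepth_le (N : ℕ) : (searchDepth N : ℝ) ≤ 4 + 2 * logLog N := by
  have hl2 : 1 / 2 < Real.log 2 := by linarith [Real.log_two_gt_d9]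
  rcases Nat.lt_or_ge N 3 with hN | hN
  · have h : searchDepth N ≤ 1 := by
      have h1 : Nat.clog 2 N ≤ 1 := Nat.clog_le_of_le_pow (by omega)
      exact Nat.clog_le_of_le_pow (by omega)
    have : (searchDepth N : ℝ) ≤ 1 := by exact_mod_cast h
    linarith [logLog_nonneg N]
  · set a := Nat.clog 2 N with ha
    set b := searchDepth N with hb
    have ha1 : 2 ^ (a - 1) < N := Nat.pow_pred_clog_lt_self one_lt_two (by omega)
    have ha0 : 0 < a := Nat.clog_pos one_lt_two (by omega)
    have hb1 : 2 ^ (b - 1) < a + 1 := Nat.pow_pred_clog_lt_self one_lt_two (by omega)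
    have hb0 : 0 < b := Nat.clog_pos one_lt_two (by omega)
    have hN' : (3 : ℝ) ≤ N := by exact_mod_cast hN
    have hlN : 1 ≤ Real.log N := by
      rw [Real.le_log_iff_exp_le (by linarith)]
      linarith [Real.exp_one_lt_d9]
    have hlog : ∀ m n : ℕ, 2 ^ m < n → (m : ℝ) * (1 / 2) ≤ Real.log n := by
      intro m n h
      have h1 : ((2 : ℝ) ^ m) ≤ n := by exact_mod_cast h.le
      have h2 := Real.log_le_log (by positivity) h1
      rw [Real.log_pow] at h2
      have : (0 : ℝ) ≤ m := Nat.cast_nonneg m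
      nlinarith
    have h1 := hlog _ _ ha1
    have h2 := hlog _ _ hb1
    rw [Nat.cast_sub ha0] at h1
    rw [Nat.cast_sub hb0] at h2
    push_cast at h1 h2
    -- `a + 1 ≤ 2 log N + 2 ≤ 4 log N`
    have h3 : Real.log (a + 1) ≤ Real.log (4 * Real.log N) := by
      refine Real.log_le_log (by positivity) ?_
      linarith
    have h4 : Real.log (4 * Real.log N) = 2 * Real.log 2 + Real.log (Real.log N) := by
      rw [Real.log_mul (by norm_num) (by linarith), show (4 : ℝ) = 2 ^ 2 by norm_num,
        Real.log_pow]
      push_cast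
      ring
    have h5 : Real.log (Real.log N) ≤ logLog N := le_max_right _ _
    linarith [Real.log_two_lt_d9]

theorem reps_le {ε : ℝ} (hε : 0 < ε) (hε1 : ε < 1 / 10) : (reps ε : ℝ) ≤ 20001 / ε ^ 2 := by
  have h1 : (reps ε : ℝ) < 20000 / ε ^ 2 + 1 := Nat.ceil_lt_add_one (by positivity)
  have h2 : 1 ≤ 1 / ε ^ 2 := by
    rw [le_div_iff₀ (by positivity)]
    nlinarith
  have h3 : 20001 / ε ^ 2 = 20000 / ε ^ 2 + 1 / ε ^ 2 := by ring
  linarith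

/-- The sample complexity, in terms of the success probability of a comparison. -/
theorem CondAlg.cost_massEstimator_le {Ω : Type u} [Fintype Ω] {μ : PMF Ω} {O : Set Ω → PMF Ω}
    {x : Ω} (hO : IsCondOracle μ O) {ε c : ℝ} (hε : 0 < ε) (hε1 : ε < 1 / 10) (hc : 0 < c)
    (hc1 : c < 1 / 16) :
    (massEstimator ε c x).cost O ≤ ENNReal.ofReal
      (24 * logLog (Fintype.card Ω) + 400000000 * (1 / (ε ^ 2 * (hitTotal μ x + c)))) := by
  set D := searchDepth (Fintype.card Ω) with hD
  have hDle : (D : ℝ) ≤ 4 + 2 * logLog (Fintype.card Ω) := searchDepth_le _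
  have hk := reps_pos hε
  have hkle := reps_le hε hε1
  have hp0 : 0 ≤ hitTotal μ x :=
    mul_nonneg (mass_nonneg μ x) (by linarith [acceptTotal_nonneg μ x])
  have hp1 : hitTotal μ x ≤ 1 := by
    rcases (mass_nonneg μ x).eq_or_lt with hx | hx
    · rw [hitTotal_eq_zero hx.symm]
      exact zero_le_one
    · exact hitTotal_le_one hx
  have hpc : 0 < hitTotal μ x + c := by linarith
  set Q := 1 / (ε ^ 2 * (hitTotal μ x + c)) with hQ
  have hQ1 : 1 ≤ 2 * Q := by
    rw [hQ, ← mul_div_assoc, le_div_iff₀ (by positivity)]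
    have : ε ^ 2 ≤ 1 := by nlinarith
    nlinarith
  -- The cost is bounded both by the budget and by the cost without a budget.
  have key : (massEstimator ε c x).cost O ≤
      ENNReal.ofReal (12 * D + 1 + 16896 * (reps ε / (hitTotal μ x + c))) := by
    rcases le_or_gt (hitTotal μ x) c with h | h
    · refine (cost_limit_le_nat O _ _).trans ?_
      rw [← ENNReal.ofReal_natCast]
      apply ENNReal.ofReal_le_ofReal
      rw [budget]
      push_cast
      have h1 : (⌈8448 * reps ε / c⌉₊ : ℝ) < 8448 * reps ε / c + 1 :=
        Nat.ceil_lt_add_one (by positivity)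
      have h2 : 8448 * reps ε / c ≤ 16896 * (reps ε / (hitTotal μ x + c)) := by
        rw [← mul_div_assoc, div_le_div_iff₀ hc hpc]
        nlinarith
      linarith
    · have hx : 0 < mass μ x := by
        refine (mass_nonneg μ x).lt_of_ne fun hx => ?_
        rw [hitTotal_eq_zero hx.symm] at h
        linarith
      refine (cost_limit_le O _ _).trans ((cost_estimator_le hO hx (one_le_reps hε)
        (le_two_pow_searchDepth _)).trans (ENNReal.ofReal_le_ofReal ?_))
      have h2 : 704 * (reps ε / hitTotal μ x) ≤ 16896 * (reps ε / (hitTotal μ x + c)) := by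
        rw [← mul_div_assoc, ← mul_div_assoc, div_le_div_iff₀ (by linarith) hpc]
        nlinarith
      have : (0 : ℝ) ≤ D := Nat.cast_nonneg D
      linarith
  refine key.trans (ENNReal.ofReal_le_ofReal ?_)
  have h3 : reps ε / (hitTotal μ x + c) ≤ 20001 * Q := by
    calc reps ε / (hitTotal μ x + c) ≤ 20001 / ε ^ 2 / (hitTotal μ x + c) := by gcongr
      _ = 20001 * Q := by rw [hQ, div_div, mul_one_div]
  linarith

theorem one_le_log_inv {ε c : ℝ} (hε : 0 < ε) (hε1 : ε < 1 / 10) (hc : 0 < c) (hc1 : c < 1 / 16) :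
    1 ≤ Real.log (1 / (ε * c)) := by
  rw [Real.le_log_iff_exp_le (by positivity), le_div_iff₀ (by positivity)]
  have h1 := Real.exp_one_lt_d9
  have h2 : ε * c ≤ 1 / 10 * (1 / 16) := by gcongr
  nlinarith [mul_pos hε hc]

theorem log_inv_nonneg {ε : ℝ} (hε : 0 < ε) (hε1 : ε < 1 / 10) : 0 ≤ Real.log (1 / ε) := by
  refine Real.log_nonneg ?_
  rw [le_div_iff₀ hε]
  linarith

/-- A cost of order `G + A` is below the sample bounds, whose main term `A` comes with a further term
`B` and a logarithmic factor `l`. -/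
theorem le_mul_add_log_mul {G A B a l K : ℝ} (hG : 0 ≤ G) (hA : 0 ≤ A) (hB : 0 ≤ B) (hl : 1 ≤ l)
    (hK : 24 ≤ K) (haK : a ≤ K * A) : 24 * G + a ≤ K * (G + l * (A + B)) := by
  have h1 : 24 * G ≤ K * G := by gcongr
  have h2 : A ≤ l * (A + B) := by nlinarith
  have h3 : K * A ≤ K * (l * (A + B)) := by gcongr
  linarith

end CondEst
end

theorem theorem4p1 :
    ∃ K : ℝ, 0 < K ∧
      ∀ (Ω : Type u) [Fintype Ω] (ε c : ℝ), 0 < ε → ε < 1 / 10 → 0 < c → c < 1 / 16 →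
        ∃ alg : Ω → CondEst.CondAlg Ω (Option ℝ),
          ∀ (μ : PMF Ω) (O : Set Ω → PMF Ω), CondEst.IsCondOracle μ O →
            -- every individual element
            (∀ x : Ω,
              (alg x).NeverAsksNull μ ∧
              CondEst.SolvesEstimationTask ε c μ x ((alg x).outputDist O) ∧
              ∀ κ η : ℝ, 0 < κ → κ < 1 / 44 → 0 < η → η < 1 →
                (alg x).expectedSamples O ≤
                  ENNReal.ofReal (K * CondEst.sampleBound (Fintype.card Ω) ε c
                    (CondEst.weight κ η μ x))) ∧
            -- the worst-case element
            (∀ x : Ω, (alg x).expectedSamples O ≤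
              ENNReal.ofReal (K * CondEst.worstCaseBound (Fintype.card Ω) ε c)) ∧
            -- an element drawn from the input distribution
            ∑ x : Ω, μ x * (alg x).expectedSamples O ≤
              ENNReal.ofReal (K * CondEst.averageBound (Fintype.card Ω) ε c) := by
  refine ⟨1600000000, by norm_num, fun Ω _ ε c hε hε1 hc hc1 =>
    ⟨CondEst.CondAlg.massEstimator ε c, fun μ O hO => ?_⟩⟩
  simp only [CondEst.CondAlg.expectedSamples_eq_cost]
  have hcost := fun x => CondEst.CondAlg.cost_massEstimator_le (x := x) hO hε hε1 hc hc1
  have hG := CondEst.logLog_nonneg (Fintype.card Ω)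
  have hl := CondEst.one_le_log_inv hε hε1 hc hc1
  have hL := CondEst.log_inv_nonneg hε hε1
  have hp0 : ∀ x, 0 ≤ CondEst.hitTotal μ x := fun x =>
    mul_nonneg (CondEst.mass_nonneg μ x) (by linarith [CondEst.acceptTotal_nonneg μ x])
  refine ⟨fun x => ⟨(CondEst.CondAlg.Safe.massEstimator hε c).neverAsksNull,
    CondEst.CondAlg.solves_massEstimator hO hε hε1 hc, fun κ η _ hκ _ _ => ?_⟩, fun x => ?_, ?_⟩
  · refine (hcost x).trans (ENNReal.ofReal_le_ofReal ?_)
    have hw0 : 0 ≤ CondEst.weight κ η μ x := CondEst.weight_nonneg hκ η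
    have hw := CondEst.weight_le (μ := μ) (x := x) hκ η
    have hp := hp0 x
    refine CondEst.le_mul_add_log_mul hG (by positivity) (by positivity) hl (by norm_num) ?_
    have h1 : 1 / (ε ^ 2 * (CondEst.hitTotal μ x + c)) ≤
        4 * (1 / (ε ^ 2 * (CondEst.weight κ η μ x + c))) := by
      rw [← mul_div_assoc, div_le_div_iff₀ (by positivity) (by positivity)]
      nlinarith [sq_nonneg ε, pow_pos hε 2]
    linarith
  · refine (hcost x).trans (ENNReal.ofReal_le_ofReal ?_)
    have hp := hp0 x
    refine CondEst.le_mul_add_log_mul hG (by positivity) (by positivity) hl (by norm_num) ?_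
    have h1 : 1 / (ε ^ 2 * (CondEst.hitTotal μ x + c)) ≤ 1 / (ε ^ 2 * c) := by
      gcongr
      linarith
    have h2 : 0 ≤ 1 / (ε ^ 2 * c) := by positivity
    linarith
  · have h1 : ∀ x, μ x * (CondEst.CondAlg.massEstimator ε c x).cost O ≤
        ENNReal.ofReal (CondEst.mass μ x * (24 * CondEst.logLog (Fintype.card Ω)) +
          800000000 / ε ^ 2 *
            (CondEst.mass μ x / (c + CondEst.cdfAt μ (CondEst.mass μ x)))) := by
      intro x
      have hm := CondEst.mass_nonneg μ x
      have hp := hp0 x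
      refine (mul_le_mul' (CondEst.ofReal_mass μ x).ge (hcost x)).trans ?_
      rw [← ENNReal.ofReal_mul hm]
      apply ENNReal.ofReal_le_ofReal
      have h2 : CondEst.cdfAt μ (CondEst.mass μ x) ≤ 2 * CondEst.hitTotal μ x := by
        rcases hm.eq_or_lt with hx | hx
        · rw [CondEst.cdfAt_eq_zero hx.symm, CondEst.hitTotal_eq_zero hx.symm, mul_zero]
        · exact CondEst.cdfAt_le hx
      have h3 : 0 ≤ CondEst.cdfAt μ (CondEst.mass μ x) := hm.trans CondEst.mass_le_cdfAt
      have h4 : 1 / (CondEst.hitTotal μ x + c) ≤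
          2 * (1 / (c + CondEst.cdfAt μ (CondEst.mass μ x))) := by
        rw [← mul_div_assoc, div_le_div_iff₀ (by positivity) (by positivity)]
        linarith
      calc _ = CondEst.mass μ x * (24 * CondEst.logLog (Fintype.card Ω)) +
            400000000 / ε ^ 2 * CondEst.mass μ x * (1 / (CondEst.hitTotal μ x + c)) := by
            field_simp
        _ ≤ CondEst.mass μ x * (24 * CondEst.logLog (Fintype.card Ω)) +
            400000000 / ε ^ 2 * CondEst.mass μ x *
              (2 * (1 / (c + CondEst.cdfAt μ (CondEst.mass μ x)))) := by gcongr
        _ = _ := by ring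
    refine (Finset.sum_le_sum fun x _ => h1 x).trans ?_
    have hcdf : ∀ x, 0 ≤ CondEst.cdfAt μ (CondEst.mass μ x) := fun x =>
      (CondEst.mass_nonneg μ x).trans CondEst.mass_le_cdfAt
    rw [← ENNReal.ofReal_sum_of_nonneg fun x _ => by
      have := CondEst.mass_nonneg μ x
      have := hcdf x
      positivity]
    apply ENNReal.ofReal_le_ofReal
    rw [Finset.sum_add_distrib, ← Finset.sum_mul, CondEst.sum_mass, one_mul, ← Finset.mul_sum]
    have h5 := CondEst.sum_div_add_cdfAt_le μ hc hc1
    have hlc := CondEst.log_inv_nonneg hc (by linarith)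
    refine CondEst.le_mul_add_log_mul hG (by positivity) (by positivity) hl (by norm_num) ?_
    calc _ ≤ 800000000 / ε ^ 2 * (2 * Real.log (1 / c)) := by gcongr
      _ = _ := by ring
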